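/- Let $\Lambda>0$, $\gamma_1,\dots,\gamma_d>0$, let $n_1,\dots,n_d\ge 1$ be integers, and let $P_0$ be a diffuse probability measure on a standard Borel space $\mathbb{X}$. All Gamma distributions are in the shape--rate parametrization, $\operatorname{Pois}(r)$ is the Poisson distribution, and $\operatorname{Pois}_1(r)$ is the law of $1+N$ with $N\sim\operatorname{Pois}(r)$. For a probability measure $q$ on $\{0,1,2,\dots\}$ and probability measures $H_1,\dots,H_d$ on $(0,\infty)$, write $(\mu_1,\dots,\mu_d)\sim\operatorname{Vec-IFPP}(q,H_1\times\dots\times H_d,P_0)$ if $\mu_j=\sum_{m=1}^{M}S_{j,m}\delta_{\tau_m}$, where $M\sim q$ and, given $M$, the $\tau_m$ are i.i.d. $P_0$, the $S_{j,1},\dots,S_{j,M}$ are i.i.d. $H_j$, and all these variables are independent. Let $(\mu_1,\dots,\mu_d)\sim\operatorname{Vec-IFPP}(q_M,H_1\times\dots\times H_d,P_0)$ with $q_M=\operatorname{Pois}_1(\Lambda)$ and $H_j=\operatorname{Gamma}(\gamma_j,1)$, and put $T_j=\mu_j(\mathbb{X})$ and $P_j=\mu_j/T_j$ (so that $(P_1,\dots,P_d)\sim\operatorname{Vec-FDP}(\Lambda,\boldsymbol\gamma,P_0)$).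 Given $(\mu_1,\dots,\mu_d)$, let the variables $\theta_{j,i}\sim P_j$ ($1\le i\le n_j$) and $U_j\sim\operatorname{Gamma}(n_j,T_j)$ ($1\le j\le d$) be all independent. Let $\theta^{**}_1,\dots,\theta^{**}_K$ be the distinct values of the array $\boldsymbol\theta=(\theta_{j,i})$, let $n_{j,k}$ be the number of $i$ with $\theta_{j,i}=\theta^{**}_k$, and let $\psi_j(u)=\int_0^\infty e^{-us}H_j(\mathrm{d}s)$. Then the conditional law of $(\mu_1,\dots,\mu_d)$ given $\boldsymbol\theta$ and $(U_1,\dots,U_d)=(u_1,\dots,u_d)$ is, for almost every value of the conditioning variables, the law of $(\mu^{(a)}_1,\dots,\mu^{(a)}_d)+(\mu^{(na)}_1,\dots,\mu^{(na)}_d)$, where the two summands are independent and (i) $\mu^{(a)}_j=\sum_{k=1}^K S^{(a)}_{j,k}\delta_{\theta^{**}_k}$ with independent $S^{(a)}_{j,k}\sim\operatorname{Gamma}(n_{j,k}+\gamma_j,\,u_j+1)$; (ii) $(\mu^{(na)}_1,\dots,\mu^{(na)}_d)\sim\operatorname{Vec-IFPP}(q^*_M,H^*_1\times\dots\times H^*_d,P_0)$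 with $H^*_j=\operatorname{Gamma}(\gamma_j,u_j+1)$, i.e. given the number $M^*\sim q^*_M$ of non-allocated components, their weights $S^{(na)}_{j,1},\dots,S^{(na)}_{j,M^*}$ are i.i.d. $\operatorname{Gamma}(\gamma_j,u_j+1)$, independently over $j$; (iii) with $r=\Lambda\prod_{j=1}^d\psi_j(u_j)$, $\displaystyle q^*_M=\frac{r}{r+K}\operatorname{Pois}_1(r)+\frac{K}{r+K}\operatorname{Pois}(r)$. Moreover, for all $u_1,\dots,u_d>0$, these are the specializations of the general expressions: $\operatorname{Gamma}(k+\gamma_j,u_j+1)$ is the probability measure proportional to $e^{-u_js}s^{k}H_j(\mathrm{d}s)$ for every integer $k\ge0$ (in particular $H_j^*(\mathrm{d}s)\propto e^{-u_js}H_j(\mathrm{d}s)$), and for every integer $K\ge0$ the mixture in (iii) is the probability distribution on $\{0,1,2,\dots\}$ with $q^*_M(m)\propto q_M(m+K)\frac{(m+K)!}{m!}\prod_{j=1}^d\psi_j(u_j)^m$. -/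

import Mathlib

open MeasureTheory ProbabilityTheory
open scoped ENNReal NNReal Nat

noncomputable section

namespace VecFDP

/-! ### Conditional laws and normalization -/

/-- `Y ∣ X = x ∼ Q x` under `P`: the map `Q` agrees, for almost every value `x` of `X`, with a
probability kernel that is a regular conditional distribution of `Y` given `X`. -/
def HasCondLaw {Ω A B : Type*} [MeasurableSpace Ω] [MeasurableSpace A] [MeasurableSpace B]
    (Y : Ω → B) (X : Ω → A) (Q : A → Measure B) (P : Measure Ω) : Prop :=
  ∃ κ : Kernel A B, IsMarkovKernel κ ∧ (∀ᵐ x ∂(P.map X), κ x = Q x) ∧ HasCondDistrib Y X κ P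

/-- The normalization `ν / ν(univ)` of a (finite, nonzero) measure. -/
def normalized {A : Type*} [MeasurableSpace A] (ν : Measure A) : Measure A :=
  (ν Set.univ)⁻¹ • ν

/-! ### Vectors of independent finite point processes -/

section RandomMeasures

variable {X : Type*} [MeasurableSpace X]

/-- The vector of random measures `μ_j = ∑_m S_{j,m} δ_{τ_m}` attached to finitely many points
`(S_m, τ_m)`, where `S_m = (S_{1,m}, …, S_{d,m})` are weights and `τ_m` atoms. -/
def atomicVector {d m : ℕ} (ξ : Fin m → (Fin d → ℝ) × X) : Fin d → Measure X :=
  fun j => ∑ i, ENNReal.ofReal ((ξ i).1 j) • Measure.dirac (ξ i).2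

/-- The law `Vec-IFPP(q, H_1 × ⋯ × H_d, P₀)` of the vector `(μ_1, …, μ_d)`: the number `M` of
components has law `q` on `ℕ`; given `M`, the atoms `τ_1, …, τ_M` are i.i.d. `P₀`, the weights
`S_{j,1}, …, S_{j,M}` are i.i.d. `H j`, everything independent; and
`μ_j = ∑_{m ≤ M} S_{j,m} δ_{τ_m}`. -/
def vecIFPP {d : ℕ} (q : Measure ℕ) (H : Fin d → Measure ℝ) (P₀ : Measure X) :
    Measure (Fin d → Measure X) :=
  Measure.sum fun m : ℕ =>
    q {m} • (Measure.pi fun _ : Fin m => (Measure.pi H).prod P₀).map atomicVector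

/-! ### The latent model -/

/-- The conditional law of the array `θ = (θ_{j,i})` given `(μ_1, …, μ_d)`: all entries are
independent, and `θ_{j,i} ∼ P_j = μ_j / μ_j(X)`. -/
def sampleLaw {d : ℕ} (n : Fin d → ℕ) (μ : Fin d → Measure X) :
    Measure ((j : Fin d) → Fin (n j) → X) :=
  Measure.pi fun j => Measure.pi fun _ => normalized (μ j)

/-- The conditional law of `U = (U_1, …, U_d)` given `(μ_1, …, μ_d)`: independent entries,
`U_j ∼ Gamma(n_j, T_j)` (shape, rate), where `T_j = μ_j(X)`. -/
def auxLaw {d : ℕ} (n : Fin d → ℕ) (μ : Fin d → Measure X) : Measure (Fin d → ℝ) :=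
  Measure.pi fun j => gammaMeasure (n j) (μ j Set.univ).toReal

open Classical in
/-- The set `{θ**_1, …, θ**_K}` of the distinct values of the whole array `θ`. -/
def distinctValues {d : ℕ} {n : Fin d → ℕ} (θ : (j : Fin d) → Fin (n j) → X) : Finset X :=
  Finset.univ.image fun p : (j : Fin d) × Fin (n j) => θ p.1 p.2

/-- The number `K` of distinct values of the array `θ`. -/
def numClusters {d : ℕ} {n : Fin d → ℕ} (θ : (j : Fin d) → Fin (n j) → X) : ℕ :=
  (distinctValues θ).card

open Classical in
/-- The count `n_{j,k}`: how many entries of the `j`-th group equal the value `x = θ**_k`. -/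
def count {d : ℕ} {n : Fin d → ℕ} (θ : (j : Fin d) → Fin (n j) → X) (j : Fin d) (x : X) : ℕ :=
  (Finset.univ.filter fun i : Fin (n j) => θ j i = x).card

/-! ### Superposition of allocated and non-allocated components -/

/-- The law of `(μ^{(a)}_1, …, μ^{(a)}_d)`, `μ^{(a)}_j = ∑_k S^{(a)}_{j,k} δ_{θ**_k}`, where the
`S^{(a)}_{j,k}` are independent with respective laws `Ha j n_{j,k}`. The distinct values are used
themselves as the indices `k`. -/
def allocatedLaw {d : ℕ} {n : Fin d → ℕ} (θ : (j : Fin d) → Fin (n j) → X)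
    (Ha : Fin d → ℕ → Measure ℝ) : Measure (Fin d → Measure X) :=
  (Measure.pi fun p : Fin d × {x // x ∈ distinctValues θ} => Ha p.1 (count θ p.1 p.2)).map
    fun s j => ∑ x : {x // x ∈ distinctValues θ},
      ENNReal.ofReal (s (j, x)) • Measure.dirac (x : X)

/-- The law of `(μ^{(a)}_1 + μ^{(na)}_1, …, μ^{(a)}_d + μ^{(na)}_d)`, where the two summands are
independent, the first one is the process of allocated components with weights
`S^{(a)}_{j,k} ∼ Ha j n_{j,k}`, and the second one, the process of non-allocated components, is a
`Vec-IFPP(q, Hna_1 × ⋯ × Hna_d, P₀)`. -/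
def superpositionLaw {d : ℕ} {n : Fin d → ℕ} (θ : (j : Fin d) → Fin (n j) → X)
    (Ha : Fin d → ℕ → Measure ℝ) (q : Measure ℕ) (Hna : Fin d → Measure ℝ) (P₀ : Measure X) :
    Measure (Fin d → Measure X) :=
  ((allocatedLaw θ Ha).prod (vecIFPP q Hna P₀)).map fun ν => ν.1 + ν.2

end RandomMeasures

/-! ### Ingredients of the posterior for general `q_M` and `H_j` -/

/-- The Laplace transform `ψ(u) = ∫ e^{-us} H(ds)`. -/
def laplace (H : Measure ℝ) (u : ℝ) : ℝ := ∫ s, Real.exp (-(u * s)) ∂H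

/-- The probability distribution proportional to `e^{-us} s^k H(ds)`. -/
def tiltedWeight (H : Measure ℝ) (u : ℝ) (k : ℕ) : Measure ℝ :=
  normalized (H.withDensity fun s => ENNReal.ofReal (Real.exp (-(u * s)) * s ^ k))

/-- The probability distribution `q*` on `{0, 1, 2, …}` with
`q*(m) ∝ q(m + K) ((m + K)! / m!) ψ^m`. -/
def qStar (q : Measure ℕ) (K : ℕ) (ψ : ℝ) : Measure ℕ :=
  normalized (Measure.sum fun m : ℕ =>
    (q {m + K} * ENNReal.ofReal (((m + K)! : ℝ) / (m ! : ℝ) * ψ ^ m)) • Measure.dirac m)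

/-! ### Ingredients of the Vec-FDP -/

/-- The 1-shifted Poisson distribution `Pois₁(r)`: the law of `1 + N` with `N ∼ Pois(r)`. -/
def shiftedPoisson (r : ℝ≥0) : Measure ℕ := (poissonMeasure r).map fun m => m + 1

/-- The mixture `(r / (r + K)) Pois₁(r) + (K / (r + K)) Pois(r)`, for `r > 0`. -/
def poissonMixture (r : ℝ) (K : ℕ) : Measure ℕ :=
  ENNReal.ofReal (r / (r + K)) • shiftedPoisson r.toNNReal
    + ENNReal.ofReal (K / (r + K)) • poissonMeasure r.toNNReal

/-- The law of the unnormalized measures `(μ_1, …, μ_d)` of a `Vec-FDP(Λ, γ, P₀)`: the `Vec-IFPP`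
with `M ∼ Pois₁(Λ)` and `S_{j,m} ∼ Gamma(γ_j, 1)`. -/
def vecFDP {X : Type*} [MeasurableSpace X] {d : ℕ} (Λ : ℝ≥0) (γ : Fin d → ℝ) (P₀ : Measure X) :
    Measure (Fin d → Measure X) :=
  vecIFPP (shiftedPoisson Λ) (fun j => gammaMeasure (γ j) 1) P₀

/-- The product `∏_j ψ_j(u_j)`, with `ψ_j` the Laplace transform of `Gamma(γ_j, 1)`. -/
def psiProd {d : ℕ} (γ u : Fin d → ℝ) : ℝ := ∏ j, laplace (gammaMeasure (γ j) 1) (u j)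

end VecFDP

end

namespace VecFDP

/-! ### Finite product measures -/

section PiMeasure

variable {ι : Type*} [Fintype ι]

/-! The theorem is Bayes' formula for a model that the auxiliary variables make tractable. Given `m`
components, sampling from the normalized measures gives the factor `∏ T_j^(-n_j)` times a sum over
labellings `c` of the entries by components, with mass `∏ S_{j,c(j,i)}`. The density of `U`
contributes `∏ T_j^(n_j) exp(-T_j u_j)` times a function of `u` alone, so the powers of `T_j` cancel
(`lintegral_sampleLaw_prod_auxLaw`). Since `T_j` is the sum of the weights, what remains factorizes
over the components into `exp(-u_j S) S^k`, with `k` the number of entries of group `j` carrying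
that label. Tilting a Gamma law in this way gives a Gamma law again
(`gammaMeasure_withDensity_tilt`).

A labelling is a partition of the entries into `K` blocks together with an injection of the blocks
into the components (`sum_labels_eq_sum_partitions`). By exchangeability all injections contribute
equally; with `m + K` components there are `(m + K)! / m!` of them, and each of the `m` components
without a label contributes `∏ ψ_j(u_j)`. These factors turn the prior on the number of components
into a constant times the Poisson mixture (`shiftedPoisson_mul_factorial_ratio`). As `P₀` is
diffuse, distinct blocks almost surely have distinct atoms, so the blocks are the ties of the
sample.

The outcome, `tsum_lintegral_prior` and then `lintegral_joint`, writes the joint law as a mixture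
over `(θ, u)` of the candidate posterior. This identifies the conditional law without a closed form
for the marginal of `(θ, U)`. It remains to see that the posterior is a kernel: it depends
measurably on the data for each of the finitely many tie patterns. -/

lemma lintegral_fin_prod_eq_prod {n : ℕ} {E : Fin n → Type*} {mE : ∀ i, MeasurableSpace (E i)}
    {μ : ∀ i, Measure (E i)} [∀ i, SigmaFinite (μ i)] (f : (i : Fin n) → E i → ℝ≥0∞)
    (hf : ∀ i, Measurable (f i)) :
    ∫⁻ x : (i : Fin n) → E i, ∏ i, f i (x i) ∂(Measure.pi μ) = ∏ i, ∫⁻ x, f i x ∂(μ i) := by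
  induction n with
  | zero => simp
  | succ n ih =>
    have hm : Measurable fun x : (i : Fin n) → E i.succ => ∏ i, f i.succ (x i) :=
      Finset.measurable_fun_prod _ fun i _ => (hf i.succ).comp (measurable_pi_apply i)
    calc _ = ∫⁻ x : E 0 × ((i : Fin n) → E i.succ), f 0 x.1 * ∏ i : Fin n, f i.succ (x.2 i)
            ∂((μ 0).prod (Measure.pi fun i => μ i.succ)) := by
          rw [← (measurePreserving_piFinSuccAbove μ 0).symm.lintegral_comp_emb
            (MeasurableEquiv.measurableEmbedding _)]
          refine lintegral_congr fun x => ?_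
          rw [Fin.prod_univ_succ]
          rfl
      _ = ∏ i, ∫⁻ x, f i x ∂(μ i) := by
          rw [Fin.prod_univ_succ, ← ih _ fun i => hf i.succ,
            ← lintegral_prod_mul (hf 0).aemeasurable hm.aemeasurable]

lemma lintegral_fintype_prod_eq_prod {E : ι → Type*} {mE : ∀ i, MeasurableSpace (E i)}
    {μ : ∀ i, Measure (E i)} [∀ i, SigmaFinite (μ i)] (f : (i : ι) → E i → ℝ≥0∞)
    (hf : ∀ i, Measurable (f i)) :
    ∫⁻ x : (i : ι) → E i, ∏ i, f i (x i) ∂(Measure.pi μ) = ∏ i, ∫⁻ x, f i x ∂(μ i) := by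
  let e := (Fintype.equivFin ι).symm
  rw [← (measurePreserving_piCongrLeft μ e).lintegral_comp_emb
    (MeasurableEquiv.measurableEmbedding _)]
  simp_rw [← e.prod_comp, MeasurableEquiv.coe_piCongrLeft, Equiv.piCongrLeft_apply_apply]
  exact lintegral_fin_prod_eq_prod (fun i => f (e i)) fun i => hf (e i)

lemma pi_withDensity {E : ι → Type*} {mE : ∀ i, MeasurableSpace (E i)}
    {μ : ∀ i, Measure (E i)} [∀ i, SigmaFinite (μ i)] (f : (i : ι) → E i → ℝ≥0∞)
    (hf : ∀ i, Measurable (f i)) [∀ i, SigmaFinite ((μ i).withDensity (f i))] :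
    Measure.pi (fun i => (μ i).withDensity (f i))
      = (Measure.pi μ).withDensity fun x => ∏ i, f i (x i) := by
  refine Measure.pi_eq fun s hs => ?_
  rw [withDensity_apply _ (MeasurableSet.univ_pi hs), ← lintegral_indicator
    (MeasurableSet.univ_pi hs)]
  have : ∀ x : (i : ι) → E i, (Set.univ.pi s).indicator (fun x => ∏ i, f i (x i)) x
      = ∏ i, (s i).indicator (f i) (x i) := by
    intro x
    by_cases hx : x ∈ Set.univ.pi s
    · rw [Set.indicator_of_mem hx]
      exact Finset.prod_congr rfl fun i _ => (Set.indicator_of_mem (hx i trivial) _).symm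
    · rw [Set.indicator_of_notMem hx]
      simp only [Set.mem_univ_pi, not_forall] at hx
      obtain ⟨i, hi⟩ := hx
      exact (Finset.prod_eq_zero (Finset.mem_univ i) (Set.indicator_of_notMem hi _)).symm
  simp_rw [this]
  rw [lintegral_fintype_prod_eq_prod _ fun i => (hf i).indicator (hs i)]
  exact Finset.prod_congr rfl fun i _ => by
    rw [lintegral_indicator (hs i), withDensity_apply _ (hs i)]

lemma pi_smul {E : ι → Type*} {mE : ∀ i, MeasurableSpace (E i)}
    {μ : ∀ i, Measure (E i)} [∀ i, IsFiniteMeasure (μ i)] (c : ι → ℝ≥0∞) (hc : ∀ i, c i ≠ ∞) :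
    Measure.pi (fun i => c i • μ i) = (∏ i, c i) • Measure.pi μ := by
  have : ∀ i, IsFiniteMeasure (c i • μ i) := fun i => Measure.smul_finite _ (hc i)
  refine Measure.pi_eq fun s _ => ?_
  simp [Finset.prod_mul_distrib]

/-- Distributivity of a product over finite sums; this is what turns i.i.d. sampling from an atomic
measure into a sum over labellings. -/
lemma pi_sum_smul_dirac {E : ι → Type*} {mE : ∀ i, MeasurableSpace (E i)} {κ : ι → Type*}
    [∀ i, Fintype (κ i)] [Fintype (∀ i, κ i)]
    (a : ∀ i, κ i → ℝ≥0∞) (ha : ∀ i l, a i l ≠ ∞) (x : ∀ i, κ i → E i) :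
    Measure.pi (fun i => ∑ l, a i l • Measure.dirac (x i l))
      = ∑ c : ∀ i, κ i, (∏ i, a i (c i)) • Measure.dirac fun i => x i (c i) := by
  classical
  have : ∀ i l, IsFiniteMeasure (a i l • Measure.dirac (x i l)) :=
    fun i l => Measure.smul_finite _ (ha i l)
  refine Measure.pi_eq fun s hs => ?_
  simp only [Measure.coe_finsetSum, Finset.sum_apply, Measure.smul_apply, smul_eq_mul]
  rw [Finset.prod_univ_sum]
  refine Finset.sum_congr (by ext; simp) fun c _ => ?_
  rw [Finset.prod_mul_distrib, Measure.dirac_apply' _ (MeasurableSet.univ_pi hs)]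
  congr 1
  by_cases hx : (fun i => x i (c i)) ∈ Set.univ.pi s
  · rw [Set.indicator_of_mem hx]
    refine (Finset.prod_eq_one fun i _ => ?_).symm
    rw [Measure.dirac_apply' _ (hs i), Set.indicator_of_mem (hx i trivial), Pi.one_apply]
  · rw [Set.indicator_of_notMem hx]
    simp only [Set.mem_univ_pi, not_forall] at hx
    obtain ⟨i, hi⟩ := hx
    refine (Finset.prod_eq_zero (Finset.mem_univ i) ?_).symm
    rw [Measure.dirac_apply' _ (hs i), Set.indicator_of_notMem hi]

lemma pi_pi_map_uncurry {κ E : Type*} [Fintype κ] [MeasurableSpace E]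
    (μ : κ → ι → Measure E) [∀ j i, IsProbabilityMeasure (μ j i)] :
    (Measure.pi fun i => Measure.pi fun j => μ j i).map
      (fun (s : ι → κ → E) (p : κ × ι) => s p.2 p.1) = Measure.pi fun p : κ × ι => μ p.1 p.2 := by
  refine (Measure.pi_eq fun s hs => ?_).symm
  rw [Measure.map_apply (by fun_prop) (MeasurableSet.univ_pi hs)]
  have : (fun (s : ι → κ → E) (p : κ × ι) => s p.2 p.1) ⁻¹' Set.univ.pi s
      = Set.univ.pi fun i => Set.univ.pi fun j => s (j, i) := by
    ext x
    simp only [Set.mem_preimage, Set.mem_univ_pi, Prod.forall]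
    exact forall_comm
  rw [this, Measure.pi_pi]
  simp_rw [Measure.pi_pi]
  rw [Fintype.prod_prod_type_right]

lemma measurable_pi_measure {A : Type*} [MeasurableSpace A] {E : ι → Type*}
    {mE : ∀ i, MeasurableSpace (E i)} (μ : ∀ i, A → Measure (E i))
    [∀ i a, IsProbabilityMeasure (μ i a)] (hμ : ∀ i, Measurable (μ i)) :
    Measurable fun a => Measure.pi fun i => μ i a := by
  refine Measurable.measure_of_isPiSystem_of_isProbabilityMeasure generateFrom_pi.symm
    isPiSystem_pi ?_
  rintro _ ⟨s, hs, rfl⟩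
  simp_rw [Measure.pi_pi]
  exact Finset.measurable_fun_prod _ fun i _ =>
    (Measure.measurable_coe (hs i trivial)).comp (hμ i)

lemma lintegral_pi_reindex {κ E : Type*} [Fintype κ] [MeasurableSpace E] (e : ι ≃ κ)
    (μ : κ → Measure E) [∀ i, SigmaFinite (μ i)] (f : (κ → E) → ℝ≥0∞) :
    ∫⁻ x, f x ∂Measure.pi μ = ∫⁻ x, f (x ∘ e.symm) ∂Measure.pi (fun i => μ (e i)) := by
  rw [← (measurePreserving_piCongrLeft μ e).lintegral_comp_emb
    (MeasurableEquiv.measurableEmbedding _)]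
  refine lintegral_congr fun x => congrArg f (funext fun k => ?_)
  obtain ⟨i, rfl⟩ := e.surjective k
  rw [MeasurableEquiv.coe_piCongrLeft, Equiv.piCongrLeft_apply_apply]
  simp

/-- Two distinct coordinates are independent, and by Fubini the diagonal is null for `μ.prod μ`, its
sections being singletons. There are finitely many pairs. -/
lemma ae_injective_pi {E : Type*} [MeasurableSpace E] [MeasurableEq E]
    (μ : Measure E) [IsProbabilityMeasure μ] [NullSingletonClass μ] :
    ∀ᵐ x ∂Measure.pi (fun _ : ι => μ), Function.Injective x := by
  have key : ∀ i j : ι, i ≠ j → ∀ᵐ x ∂Measure.pi (fun _ : ι => μ), x i ≠ x j := by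
    intro i j hij
    have hind := (iIndepFun_pi (μ := fun _ : ι => μ) (X := fun _ x => x)
      fun _ => aemeasurable_id).indepFun hij
    rw [indepFun_iff_map_prod_eq_prod_map_map (measurable_pi_apply i).aemeasurable
      (measurable_pi_apply j).aemeasurable] at hind
    have hi : ∀ k : ι, (Measure.pi fun _ : ι => μ).map (fun x => x k) = μ :=
      fun k => (measurePreserving_eval (fun _ : ι => μ) k).map_eq
    rw [hi, hi] at hind
    have hd : MeasurableSet {p : E × E | p.1 = p.2} :=
      measurableSet_eq_fun measurable_fst measurable_snd
    have h0 : μ.prod μ {p : E × E | p.1 = p.2} = 0 := by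
      rw [Measure.prod_apply hd]
      simp [Set.preimage]
    rw [← hind, Measure.map_apply (by fun_prop) hd] at h0
    rw [ae_iff]
    simpa using h0
  have := ae_all_iff.2 fun i => ae_all_iff.2 fun j => ae_all_iff.2 (key i j)
  filter_upwards [this] with x hx i j h
  by_contra hne
  exact hx i j hne h

end PiMeasure

/-! ### Normalization -/

lemma normalized_smul {A : Type*} [MeasurableSpace A] (ν : Measure A) [IsProbabilityMeasure ν]
    {c : ℝ≥0∞} (h0 : c ≠ 0) (ht : c ≠ ∞) : normalized (c • ν) = ν := by
  rw [normalized, Measure.smul_apply, measure_univ, smul_eq_mul, mul_one, smul_smul,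
    ENNReal.inv_mul_cancel h0 ht, one_smul]

/-! ### Gamma distributions -/

/-- The total mass `∫ e^{-us} s^k Gamma(γ, 1)(ds)`. -/
noncomputable def gammaWeight (γ : ℝ) (k : ℕ) (u : ℝ) : ℝ :=
  Real.Gamma (k + γ) / Real.Gamma γ / (u + 1) ^ (k + γ)

lemma gammaWeight_pos {γ u : ℝ} (hγ : 0 < γ) (k : ℕ) (hu : 0 ≤ u) : 0 < gammaWeight γ k u := by
  have h1 := Real.Gamma_pos_of_pos hγ
  have h2 : 0 < Real.Gamma (k + γ) := Real.Gamma_pos_of_pos (by positivity)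
  have h3 : 0 < (u + 1) ^ (k + γ) := Real.rpow_pos_of_pos (by linarith) _
  unfold gammaWeight
  positivity

lemma measurable_gammaWeight (γ : ℝ) (k : ℕ) : Measurable (gammaWeight γ k) := by
  unfold gammaWeight
  fun_prop

lemma measurable_gammaPDF (a r : ℝ) : Measurable (gammaPDF a r) :=
  (measurable_gammaPDFReal a r).ennreal_ofReal

/-- Conjugacy: the tilt raises the shape by `k` and the rate by `u`, and the ratio of the
normalizing constants is `gammaWeight`. -/
lemma gammaMeasure_withDensity_tilt {γ u : ℝ} (hγ : 0 < γ) (hu : 0 ≤ u) (k : ℕ) :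
    (gammaMeasure γ 1).withDensity (fun s => ENNReal.ofReal (Real.exp (-(u * s)) * s ^ k))
      = ENNReal.ofReal (gammaWeight γ k u) • gammaMeasure (k + γ) (u + 1) := by
  have hG := Real.Gamma_pos_of_pos hγ
  have hG' : 0 < Real.Gamma (k + γ) := Real.Gamma_pos_of_pos (by positivity)
  have hu' : 0 < (u + 1) ^ (k + γ) := Real.rpow_pos_of_pos (by linarith) _
  unfold gammaMeasure
  rw [← withDensity_mul _ (measurable_gammaPDF _ _) (by fun_prop),
    ← withDensity_smul _ (measurable_gammaPDF _ _)]
  refine withDensity_congr_ae ?_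
  -- The origin is discarded because splitting the real power `s ^ (k + γ - 1)` requires `s > 0`.
  filter_upwards [Measure.ae_ne volume (0 : ℝ)] with s hs
  simp only [Pi.mul_apply, Pi.smul_apply, smul_eq_mul]
  rcases lt_or_gt_of_ne hs with h | h
  · rw [gammaPDF_of_neg h, gammaPDF_of_neg h]
    simp
  · rw [gammaPDF_of_nonneg h.le, gammaPDF_of_nonneg h.le, ← ENNReal.ofReal_mul (by positivity),
      ← ENNReal.ofReal_mul (gammaWeight_pos hγ k hu).le]
    congr 1
    have e1 : s ^ (k + γ - 1) = s ^ k * s ^ (γ - 1) := by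
      rw [← Real.rpow_natCast, ← Real.rpow_add h]
      congr 1
      ring
    have e2 : Real.exp (-((u + 1) * s)) = Real.exp (-(1 * s)) * Real.exp (-(u * s)) := by
      rw [← Real.exp_add]
      congr 1
      ring
    rw [e1, e2, gammaWeight, Real.one_rpow]
    field_simp

lemma tiltedWeight_gammaMeasure {γ u : ℝ} (hγ : 0 < γ) (hu : 0 ≤ u) (k : ℕ) :
    tiltedWeight (gammaMeasure γ 1) u k = gammaMeasure (k + γ) (u + 1) := by
  have : IsProbabilityMeasure (gammaMeasure (k + γ) (u + 1)) :=
    isProbabilityMeasure_gammaMeasure (by positivity) (by positivity)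
  rw [tiltedWeight, gammaMeasure_withDensity_tilt hγ hu, normalized_smul _ _ ENNReal.ofReal_ne_top]
  simpa using gammaWeight_pos hγ k hu

lemma laplace_gammaMeasure {γ u : ℝ} (hγ : 0 < γ) (hu : 0 ≤ u) :
    laplace (gammaMeasure γ 1) u = gammaWeight γ 0 u := by
  have : IsProbabilityMeasure (gammaMeasure ((0 : ℕ) + γ) (u + 1)) :=
    isProbabilityMeasure_gammaMeasure (by simpa using hγ) (by positivity)
  have h := congrArg (fun ν : Measure ℝ => ν Set.univ) (gammaMeasure_withDensity_tilt hγ hu 0)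
  simp only [withDensity_apply _ MeasurableSet.univ, Measure.restrict_univ, pow_zero, mul_one,
    Measure.smul_apply, measure_univ, smul_eq_mul] at h
  rw [laplace, integral_eq_lintegral_of_nonneg_ae (ae_of_all _ fun _ => (Real.exp_pos _).le)
    (by fun_prop), h, ENNReal.toReal_ofReal (gammaWeight_pos hγ 0 hu).le]

lemma psiProd_eq {d : ℕ} {γ u : Fin d → ℝ} (hγ : ∀ j, 0 < γ j) (hu : ∀ j, 0 ≤ u j) :
    psiProd γ u = ∏ j, gammaWeight (γ j) 0 (u j) :=
  Finset.prod_congr rfl fun j _ => laplace_gammaMeasure (hγ j) (hu j)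

lemma psiProd_pos {d : ℕ} {γ u : Fin d → ℝ} (hγ : ∀ j, 0 < γ j) (hu : ∀ j, 0 ≤ u j) :
    0 < psiProd γ u := by
  rw [psiProd_eq hγ hu]
  exact Finset.prod_pos fun j _ => gammaWeight_pos (hγ j) 0 (hu j)

lemma ae_pos_gammaMeasure (a r : ℝ) : ∀ᵐ s ∂gammaMeasure a r, 0 < s := by
  rw [gammaMeasure, ae_withDensity_iff (measurable_gammaPDF a r)]
  filter_upwards [Measure.ae_ne volume (0 : ℝ)] with s hs hpdf
  rcases lt_or_gt_of_ne hs with h | h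
  · exact absurd (gammaPDF_of_neg h) hpdf
  · exact h

lemma measurable_gammaMeasure {A : Type*} [MeasurableSpace A] (a : ℝ) {b : A → ℝ}
    (hb : Measurable b) : Measurable fun y => gammaMeasure a (b y) := by
  refine Measure.measurable_of_measurable_coe _ fun s hs => ?_
  simp_rw [gammaMeasure, withDensity_apply _ hs]
  refine Measurable.lintegral_prod_right' (f := fun p : A × ℝ => gammaPDF a (b p.1) p.2) ?_
  refine Measurable.ennreal_ofReal (Measurable.ite (measurableSet_le measurable_const
    measurable_snd) ?_ measurable_const)
  fun_prop

/-- The factor of the `Gamma(n, T)` density that does not depend on the rate `T`. -/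
noncomputable def gammaBase (n : ℕ) (u : ℝ) : ℝ≥0∞ :=
  ENNReal.ofReal (if 0 ≤ u then u ^ ((n : ℝ) - 1) / Real.Gamma n else 0)

lemma gammaBase_of_neg (n : ℕ) {u : ℝ} (hu : u < 0) : gammaBase n u = 0 := by
  simp [gammaBase, not_le.2 hu]

lemma measurable_gammaBase (n : ℕ) : Measurable (gammaBase n) :=
  Measurable.ennreal_ofReal
    (Measurable.ite measurableSet_Ici (by fun_prop) measurable_const)

/-- Isolates the power `T ^ n`, which later cancels the normalization of the `n` sampling laws. -/
lemma gammaPDF_eq_base {n : ℕ} (hn : 0 < n) {T : ℝ} (hT : 0 < T) (u : ℝ) :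
    gammaPDF n T u
      = ENNReal.ofReal T ^ n * (gammaBase n u * ENNReal.ofReal (Real.exp (-(T * u)))) := by
  rcases lt_or_ge u 0 with h | h
  · rw [gammaPDF_of_neg h, gammaBase_of_neg n h]
    simp
  · have hG : 0 < Real.Gamma n := Real.Gamma_pos_of_pos (by exact_mod_cast hn)
    have h' : 0 ≤ u ^ ((n : ℝ) - 1) := Real.rpow_nonneg h _
    rw [gammaPDF_of_nonneg h, gammaBase, if_pos h, ← ENNReal.ofReal_mul (by positivity),
      ← ENNReal.ofReal_pow hT.le, ← ENNReal.ofReal_mul (by positivity), Real.rpow_natCast]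
    congr 1
    ring

/-! ### Poisson distributions -/

lemma shiftedPoisson_singleton_zero (r : ℝ≥0) : shiftedPoisson r {0} = 0 := by
  rw [shiftedPoisson, Measure.map_apply .of_discrete (measurableSet_singleton _)]
  have : (fun m : ℕ => m + 1) ⁻¹' {0} = ∅ := by ext; simp
  rw [this, measure_empty]

lemma shiftedPoisson_singleton_succ (r : ℝ≥0) (m : ℕ) :
    shiftedPoisson r {m + 1} = ENNReal.ofReal (Real.exp (-r) * r ^ m / m !) := by
  rw [shiftedPoisson, Measure.map_apply .of_discrete (measurableSet_singleton _)]
  have : (fun m : ℕ => m + 1) ⁻¹' {m + 1} = {m} := by ext; simp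
  rw [this, poissonMeasure_singleton]

instance (r : ℝ≥0) : IsProbabilityMeasure (shiftedPoisson r) :=
  Measure.isProbabilityMeasure_map .of_discrete

lemma isProbabilityMeasure_poissonMixture {r : ℝ} (hr : 0 < r) (K : ℕ) :
    IsProbabilityMeasure (poissonMixture r K) where
  measure_univ := by
    simp only [poissonMixture, Measure.coe_add, Measure.coe_smul, Pi.add_apply, Pi.smul_apply,
      measure_univ, smul_eq_mul, mul_one]
    rw [← ENNReal.ofReal_add (by positivity) (by positivity), ← add_div, div_self (by positivity),
      ENNReal.ofReal_one]

/-- `Pois₁(r)` has mass `m / r` times that of `Pois(r)` at `m`, so the mixture reweights `Pois(r)`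
by `(m + K) / (r + K)`. -/
lemma poissonMixture_singleton {r : ℝ} (hr : 0 < r) (K m : ℕ) :
    poissonMixture r K {m}
      = ENNReal.ofReal (Real.exp (-r) * r ^ m / m ! * ((m + K) / (r + K))) := by
  simp only [poissonMixture, Measure.coe_add, Measure.coe_smul, Pi.add_apply, Pi.smul_apply,
    smul_eq_mul, poissonMeasure_singleton, Real.coe_toNNReal r hr.le]
  cases m with
  | zero =>
    rw [shiftedPoisson_singleton_zero, ← ENNReal.ofReal_mul (by positivity)]
    simp
    ring_nf
  | succ m =>
    rw [shiftedPoisson_singleton_succ, ← ENNReal.ofReal_mul (by positivity),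
      ← ENNReal.ofReal_mul (by positivity), ← ENNReal.ofReal_add (by positivity) (by positivity)]
    congr 1
    rw [Real.coe_toNNReal r hr.le, Nat.factorial_succ]
    push_cast
    field_simp
    ring

/-- The total mass of the weights `q(m + K) ((m + K)! / m!) ψ^m` for `q = Pois₁(Λ)`. -/
noncomputable def poissonMixtureConst (Λ ψ : ℝ) (K : ℕ) : ℝ :=
  Real.exp (Λ * ψ - Λ) * Λ ^ K / Λ * (Λ * ψ + K)

lemma poissonMixtureConst_pos {Λ ψ : ℝ} (hΛ : 0 < Λ) (hψ : 0 < ψ) (K : ℕ) :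
    0 < poissonMixtureConst Λ ψ K := by
  unfold poissonMixtureConst
  positivity

/-- For `p = m + K`, `Pois₁(Λ)` has mass `exp(-Λ) Λ^(p-1) p / p!`; the factorial ratio cancels `p!`
and leaves `(Λψ)^m / m!` times the linear factor `m + K`. -/
lemma shiftedPoisson_mul_factorial_ratio {Λ : ℝ≥0} (hΛ : 0 < Λ) {ψ : ℝ} (hψ : 0 < ψ) (K m : ℕ) :
    shiftedPoisson Λ {m + K} * ENNReal.ofReal (((m + K)! : ℝ) / (m ! : ℝ) * ψ ^ m)
      = ENNReal.ofReal (poissonMixtureConst Λ ψ K) * poissonMixture (Λ * ψ) K {m} := by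
  have hΛ' : (0 : ℝ) < Λ := hΛ
  have hr : 0 < Λ * ψ := by positivity
  rw [poissonMixture_singleton hr, ← ENNReal.ofReal_mul (poissonMixtureConst_pos hΛ' hψ K).le]
  have hconst : poissonMixtureConst Λ ψ K * (Real.exp (-(Λ * ψ)) * (Λ * ψ) ^ m / m !
      * ((m + K) / (Λ * ψ + K))) = Real.exp (-Λ) * Λ ^ (m + K) / Λ * (m + K) * ψ ^ m / m ! := by
    have : Real.exp (-Λ) = Real.exp (Λ * ψ - Λ) * Real.exp (-(Λ * ψ)) := by
      rw [← Real.exp_add]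
      congr 1
      ring
    have h0 : Λ * ψ + K ≠ 0 := by positivity
    rw [poissonMixtureConst, this, mul_pow, pow_add]
    field_simp
  rw [hconst]
  rcases hp : m + K with _ | p
  -- The shifted Poisson law has no mass at `0`, in agreement with the vanishing factor `m + K`.
  · obtain ⟨rfl, rfl⟩ : m = 0 ∧ K = 0 := by omega
    simp [shiftedPoisson_singleton_zero]
  · rw [shiftedPoisson_singleton_succ, ← ENNReal.ofReal_mul (by positivity)]
    have : (m : ℝ) + K = p + 1 := by exact_mod_cast hp
    rw [this, Nat.factorial_succ, pow_succ]
    push_cast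
    congr 1
    field_simp

lemma qStar_shiftedPoisson {Λ : ℝ≥0} (hΛ : 0 < Λ) {ψ : ℝ} (hψ : 0 < ψ) (K : ℕ) :
    qStar (shiftedPoisson Λ) K ψ = poissonMixture (Λ * ψ) K := by
  have hr : 0 < Λ * ψ := mul_pos hΛ hψ
  have := isProbabilityMeasure_poissonMixture hr K
  have h : (Measure.sum fun m : ℕ => (shiftedPoisson Λ {m + K}
      * ENNReal.ofReal (((m + K)! : ℝ) / (m ! : ℝ) * ψ ^ m)) • Measure.dirac m)
      = ENNReal.ofReal (poissonMixtureConst Λ ψ K) • poissonMixture (Λ * ψ) K := by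
    refine Measure.ext_of_singleton fun m => ?_
    rw [Measure.sum_smul_dirac_singleton, shiftedPoisson_mul_factorial_ratio hΛ hψ]
    rfl
  rw [qStar, h, normalized_smul _ _ ENNReal.ofReal_ne_top]
  simpa using poissonMixtureConst_pos hΛ hψ K

lemma measurable_poissonMixture_singleton {A : Type*} [MeasurableSpace A] {r : A → ℝ}
    (hr : ∀ a, 0 < r a) (hm : Measurable r) (K m : ℕ) :
    Measurable fun a => poissonMixture (r a) K {m} := by
  simp_rw [fun a => poissonMixture_singleton (hr a)]
  fun_prop

/-! ### Integration against product measures -/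

section PiIntegral

variable {ι κ E : Type*} [Fintype ι] [Fintype κ] [MeasurableSpace E]

lemma lintegral_pi_sum (μ : ι ⊕ κ → Measure E) [∀ i, SigmaFinite (μ i)]
    {f : (ι ⊕ κ → E) → ℝ≥0∞} (hf : Measurable f) :
    ∫⁻ x, f x ∂Measure.pi μ = ∫⁻ x, ∫⁻ y, f (Sum.elim x y)
      ∂Measure.pi (fun k => μ (.inr k)) ∂Measure.pi (fun i => μ (.inl i)) := by
  rw [← (measurePreserving_sumPiEquivProdPi_symm μ).lintegral_comp_emb
    (MeasurableEquiv.measurableEmbedding _),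
    lintegral_prod _ (by fun_prop)]
  refine lintegral_congr fun x => lintegral_congr fun y => congrArg f (funext fun i => ?_)
  cases i <;> rfl

/-- The atoms are integrated outermost because the sample and its ties depend on the atoms only. -/
lemma lintegral_pi_weights_atoms {F : Type*} [MeasurableSpace F] (μ : κ → ι → Measure E)
    [∀ j i, IsProbabilityMeasure (μ j i)] (ν : Measure F) [IsProbabilityMeasure ν]
    {f : (ι → (κ → E) × F) → ℝ≥0∞} (hf : Measurable f) :
    ∫⁻ x, f x ∂Measure.pi (fun i => (Measure.pi fun j => μ j i).prod ν)
      = ∫⁻ t, ∫⁻ s, f (fun i => (fun j => s (j, i), t i))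
        ∂Measure.pi (fun p : κ × ι => μ p.1 p.2) ∂Measure.pi (fun _ : ι => ν) := by
  have hmp := measurePreserving_arrowProdEquivProdArrow (κ → E) F ι
    (fun i => Measure.pi fun j => μ j i) (fun _ => ν)
  rw [← hmp.symm.lintegral_comp_emb (MeasurableEquiv.measurableEmbedding _),
    lintegral_prod_symm _ (by fun_prop)]
  refine lintegral_congr fun t => ?_
  rw [← pi_pi_map_uncurry μ, lintegral_map _ (by fun_prop)]
  · rfl
  · exact hf.comp (by fun_prop)

end PiIntegral

/-! ### Atomic random measures -/

lemma measurable_smul_dirac {A X : Type*} [MeasurableSpace A] [MeasurableSpace X] {f : A → ℝ≥0∞}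
    {g : A → X} (hf : Measurable f) (hg : Measurable g) :
    Measurable fun a => f a • Measure.dirac (g a) := by
  refine Measure.measurable_of_measurable_coe _ fun s hs => ?_
  simp only [Measure.smul_apply, smul_eq_mul]
  exact hf.mul ((Measure.measurable_coe hs).comp (Measure.measurable_dirac.comp hg))

section Atomic

variable {X : Type*} [MeasurableSpace X] {d : ℕ} {ι κ : Type*} [Fintype ι] [Fintype κ]

/-- The vector `μ_j = ∑_i S_{j,i} δ_{τ_i}`, with points indexed by a finite type. -/
noncomputable def atomicSum (ξ : ι → (Fin d → ℝ) × X) : Fin d → Measure X :=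
  fun j => ∑ i, ENNReal.ofReal ((ξ i).1 j) • Measure.dirac (ξ i).2

lemma measurable_atomicSum :
    Measurable (atomicSum : (ι → (Fin d → ℝ) × X) → Fin d → Measure X) := by
  refine measurable_pi_lambda _ fun j => ?_
  exact Finset.measurable_fun_sum _ fun i _ => measurable_smul_dirac (by fun_prop) (by fun_prop)

lemma measurable_atomicVector {m : ℕ} :
    Measurable (atomicVector : (Fin m → (Fin d → ℝ) × X) → Fin d → Measure X) :=
  measurable_atomicSum

lemma atomicSum_sumElim (x : ι → (Fin d → ℝ) × X) (y : κ → (Fin d → ℝ) × X) :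
    atomicSum (Sum.elim x y) = atomicSum x + atomicSum y := by
  funext j
  simp [atomicSum, Fintype.sum_sum_type]

lemma atomicSum_comp_equiv (e : ι ≃ κ) (ξ : κ → (Fin d → ℝ) × X) :
    atomicSum (ξ ∘ e) = atomicSum ξ := by
  funext j
  exact e.sum_comp fun k => ENNReal.ofReal ((ξ k).1 j) • Measure.dirac (ξ k).2

lemma lintegral_vecIFPP (q : Measure ℕ) (H : Fin d → Measure ℝ) (P₀ : Measure X)
    {f : (Fin d → Measure X) → ℝ≥0∞} (hf : Measurable f) :
    ∫⁻ ν, f ν ∂vecIFPP q H P₀ = ∑' m : ℕ, q {m} * ∫⁻ ξ, f (atomicVector ξ)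
      ∂Measure.pi (fun _ : Fin m => (Measure.pi H).prod P₀) := by
  rw [vecIFPP, lintegral_sum_measure]
  refine tsum_congr fun m => ?_
  rw [lintegral_smul_measure, lintegral_map hf measurable_atomicVector, smul_eq_mul]

lemma tsum_singleton_eq_one (q : Measure ℕ) [IsProbabilityMeasure q] : ∑' m : ℕ, q {m} = 1 := by
  have := lintegral_countable' (μ := q) fun _ : ℕ => 1
  simpa using this.symm

lemma isProbabilityMeasure_vecIFPP (q : Measure ℕ) [IsProbabilityMeasure q]
    (H : Fin d → Measure ℝ) [∀ j, IsProbabilityMeasure (H j)] (P₀ : Measure X)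
    [IsProbabilityMeasure P₀] : IsProbabilityMeasure (vecIFPP q H P₀) where
  measure_univ := by
    rw [← lintegral_one, lintegral_vecIFPP _ _ _ measurable_const]
    simp [tsum_singleton_eq_one]

end Atomic

/-! ### Labelled samples -/

section Labels

variable {d : ℕ} {n : Fin d → ℕ}

open Classical in
/-- The number of entries of the `j`-th row of `c` that are equal to `l`. -/
noncomputable def labelCount {ι : Type*} (c : (j : Fin d) → Fin (n j) → ι) (l : ι) (j : Fin d) :
    ℕ :=
  (Finset.univ.filter fun i : Fin (n j) => c j i = l).card

lemma labelCount_comp_injective {ι κ : Type*} {e : ι → κ} (he : Function.Injective e)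
    (c : (j : Fin d) → Fin (n j) → ι) (l : ι) (j : Fin d) :
    labelCount (fun j i => e (c j i)) (e l) j = labelCount c l j := by
  unfold labelCount
  congr 1
  ext i
  simp [he.eq_iff]

lemma labelCount_inl_inr {ι κ : Type*} (c : (j : Fin d) → Fin (n j) → ι) (l : κ) (j : Fin d) :
    labelCount (fun j i => (Sum.inl (c j i) : ι ⊕ κ)) (.inr l) j = 0 := by
  simp [labelCount]

lemma prod_comp_label {ι M : Type*} [Fintype ι] [CommMonoid M] (c : (j : Fin d) → Fin (n j) → ι)
    (a : ι → Fin d → M) :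
    ∏ j, ∏ i, a (c j i) j = ∏ l, ∏ j, a l j ^ labelCount c l j := by
  classical
  rw [Finset.prod_comm]
  refine Finset.prod_congr rfl fun j _ => ?_
  rw [← Finset.prod_fiberwise (s := Finset.univ) (g := c j)]
  refine Finset.prod_congr rfl fun l _ => ?_
  rw [Finset.prod_congr rfl (g := fun _ => a l j), Finset.prod_const, labelCount]
  · congr!
    simp_all

/-- The block of each entry in a partition of the entries. -/
def blockOf (s : Setoid ((j : Fin d) × Fin (n j))) (j : Fin d) (i : Fin (n j)) : Quotient s :=
  Quotient.mk s ⟨j, i⟩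

lemma blockOf_surjective (s : Setoid ((j : Fin d) × Fin (n j))) (b : Quotient s) :
    ∃ j i, blockOf s j i = b := by
  induction b using Quotient.inductionOn with
  | h p => exact ⟨p.1, p.2, rfl⟩

noncomputable instance {α : Type*} [Finite α] : Fintype (Setoid α) :=
  @Fintype.ofFinite _ (Finite.of_injective (fun s : Setoid α => s.r) fun s t h => by
    cases s; cases t; simp_all)

open Classical in
/-- A labelling amounts to a partition of the entries and an injective labelling of its blocks. -/
lemma sum_labels_eq_sum_partitions {A M : Type*} [Fintype A] [AddCommMonoid M]
    [∀ s : Setoid ((j : Fin d) × Fin (n j)), Fintype (Quotient s ↪ A)]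
    (f : ((j : Fin d) → Fin (n j) → A) → M) :
    ∑ c, f c = ∑ s : Setoid ((j : Fin d) × Fin (n j)), ∑ e : Quotient s ↪ A,
      f fun j i => e (blockOf s j i) := by
  -- Group the labellings by their kernel: those with kernel `s` are exactly the injections of the
  -- quotient by `s`, through `Setoid.kerLift`.
  rw [← Finset.sum_fiberwise (s := Finset.univ)
    (g := fun c : (j : Fin d) → Fin (n j) → A =>
      Setoid.ker fun p : (j : Fin d) × Fin (n j) => c p.1 p.2)]
  refine Finset.sum_congr rfl fun s _ => ?_
  symm
  refine Finset.sum_bij (fun e _ j i => e (blockOf s j i)) ?_ ?_ ?_ fun _ _ => rfl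
  · intro e _
    rw [Finset.mem_filter]
    refine ⟨Finset.mem_univ _, Setoid.ext fun p q => ?_⟩
    rw [Setoid.ker_def, e.injective.eq_iff]
    exact Quotient.eq
  · intro e _ e' _ h
    ext b
    induction b using Quotient.inductionOn with
    | h p => exact congrFun (congrFun h p.1) p.2
  · intro c hc
    obtain rfl := (Finset.mem_filter.1 hc).2
    exact ⟨⟨_, Setoid.kerLift_injective _⟩, Finset.mem_univ _, rfl⟩

end Labels

/-! ### Exponential tilting of the components -/

section Tilting

variable {X : Type*} [MeasurableSpace X] {d : ℕ} {ι κ : Type*} [Fintype ι] [Fintype κ]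

/-- The law of independent points with weights `S_{j,l} ∼ Gamma(k_{l,j} + γ_j, u_j + 1)` and atoms
`τ_l ∼ P₀`. -/
noncomputable def tiltedPoints (γ u : Fin d → ℝ) (P₀ : Measure X) (k : ι → Fin d → ℕ) :
    Measure (ι → (Fin d → ℝ) × X) :=
  Measure.pi fun l => (Measure.pi fun j => gammaMeasure (k l j + γ j) (u j + 1)).prod P₀

lemma isProbabilityMeasure_gammaMeasure_tilted {γ u : ℝ} (hγ : 0 < γ) (hu : 0 ≤ u) (k : ℕ) :
    IsProbabilityMeasure (gammaMeasure (k + γ) (u + 1)) :=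
  isProbabilityMeasure_gammaMeasure (by positivity) (by positivity)

/-- The density is a product over components and groups and ignores the atoms, so every weight law
is tilted separately. -/
lemma pi_withDensity_tilt {γ u : Fin d → ℝ} (hγ : ∀ j, 0 < γ j) (hu : ∀ j, 0 ≤ u j)
    (P₀ : Measure X) [IsProbabilityMeasure P₀] (k : ι → Fin d → ℕ) :
    (Measure.pi fun _ : ι => (Measure.pi fun j => gammaMeasure (γ j) 1).prod P₀).withDensity
      (fun ξ => ∏ l, ∏ j, ENNReal.ofReal (Real.exp (-(u j * (ξ l).1 j)) * (ξ l).1 j ^ k l j))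
      = (∏ l, ∏ j, ENNReal.ofReal (gammaWeight (γ j) (k l j) (u j))) • tiltedPoints γ u P₀ k := by
  have hp : ∀ j, IsProbabilityMeasure (gammaMeasure (γ j) 1) :=
    fun j => isProbabilityMeasure_gammaMeasure (hγ j) one_pos
  have hp' : ∀ l j, IsProbabilityMeasure (gammaMeasure (k l j + γ j) (u j + 1)) :=
    fun l j => isProbabilityMeasure_gammaMeasure_tilted (hγ j) (hu j) _
  have hfin : ∀ l j, IsFiniteMeasure ((gammaMeasure (γ j) 1).withDensity
      fun s => ENNReal.ofReal (Real.exp (-(u j * s)) * s ^ k l j)) := by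
    intro l j
    rw [gammaMeasure_withDensity_tilt (hγ j) (hu j)]
    exact Measure.smul_finite _ ENNReal.ofReal_ne_top
  have key : ∀ l, ((Measure.pi fun j => gammaMeasure (γ j) 1).prod P₀).withDensity
      (fun p => ∏ j, ENNReal.ofReal (Real.exp (-(u j * p.1 j)) * p.1 j ^ k l j))
      = (∏ j, ENNReal.ofReal (gammaWeight (γ j) (k l j) (u j))) •
        (Measure.pi fun j => gammaMeasure (k l j + γ j) (u j + 1)).prod P₀ := by
    intro l
    rw [← prod_withDensity_left (μ := Measure.pi fun j => gammaMeasure (γ j) 1) (ν := P₀)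
        (f := fun s => ∏ j, ENNReal.ofReal (Real.exp (-(u j * s j)) * s j ^ k l j)) (by fun_prop),
      ← pi_withDensity (fun j s => ENNReal.ofReal (Real.exp (-(u j * s)) * s ^ k l j))
        fun j => by fun_prop]
    simp_rw [gammaMeasure_withDensity_tilt (hγ _) (hu _)]
    rw [pi_smul _ fun j => ENNReal.ofReal_ne_top, Measure.prod_smul_left]
  have hc : ∀ l, ∏ j, ENNReal.ofReal (gammaWeight (γ j) (k l j) (u j)) ≠ ∞ :=
    fun l => ENNReal.prod_ne_top fun j _ => ENNReal.ofReal_ne_top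
  have hfin' : ∀ l, IsFiniteMeasure (((Measure.pi fun j => gammaMeasure (γ j) 1).prod
      P₀).withDensity fun p =>
        ∏ j, ENNReal.ofReal (Real.exp (-(u j * p.1 j)) * p.1 j ^ k l j)) := by
    intro l
    rw [key]
    exact Measure.smul_finite _ (hc l)
  rw [← pi_withDensity (fun l (p : (Fin d → ℝ) × X) =>
    ∏ j, ENNReal.ofReal (Real.exp (-(u j * p.1 j)) * p.1 j ^ k l j)) fun l => by fun_prop]
  simp_rw [key]
  rw [pi_smul _ hc, tiltedPoints]

/-- Exchangeability: renaming the components changes neither the atomic measures nor the labelled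
sample. -/
lemma lintegral_tiltedPoints_reindex {γ u : Fin d → ℝ} (hγ : ∀ j, 0 < γ j) (hu : ∀ j, 0 ≤ u j)
    (P₀ : Measure X) [IsProbabilityMeasure P₀] (e : ι ≃ κ) {n : Fin d → ℕ}
    (c : (j : Fin d) → Fin (n j) → ι)
    (F : (Fin d → Measure X) → ((j : Fin d) → Fin (n j) → X) → ℝ≥0∞) :
    ∫⁻ ξ, F (atomicSum ξ) (fun j i => (ξ (e (c j i))).2)
        ∂tiltedPoints γ u P₀ (labelCount fun j i => e (c j i))
      = ∫⁻ ξ, F (atomicSum ξ) (fun j i => (ξ (c j i)).2) ∂tiltedPoints γ u P₀ (labelCount c) := by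
  have hp' : ∀ (k : ℕ) j, IsProbabilityMeasure (gammaMeasure (k + γ j) (u j + 1)) :=
    fun k j => isProbabilityMeasure_gammaMeasure_tilted (hγ j) (hu j) _
  rw [tiltedPoints, lintegral_pi_reindex e, tiltedPoints]
  simp_rw [labelCount_comp_injective e.injective, atomicSum_comp_equiv]
  simp

/-- Allocated components are indexed by `ι` and the others by `κ`. The latter have label count zero,
hence only their rates change. -/
lemma lintegral_tiltedPoints_inl {γ u : Fin d → ℝ} (hγ : ∀ j, 0 < γ j) (hu : ∀ j, 0 ≤ u j)
    (P₀ : Measure X) [IsProbabilityMeasure P₀] {n : Fin d → ℕ}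
    (g : (j : Fin d) → Fin (n j) → ι)
    {F : (Fin d → Measure X) → ((j : Fin d) → Fin (n j) → X) → ℝ≥0∞}
    (hF : Measurable (Function.uncurry F)) :
    ∫⁻ ξ, F (atomicSum ξ) (fun j i => (ξ (.inl (g j i))).2)
        ∂tiltedPoints γ u P₀ (labelCount fun j i => (Sum.inl (g j i) : ι ⊕ κ))
      = ∫⁻ t, ∫⁻ s, ∫⁻ ξ, F (atomicSum (fun l => (fun j => s (j, l), t l)) + atomicSum ξ)
          (fun j i => t (g j i))
          ∂Measure.pi (fun _ : κ => (Measure.pi fun j => gammaMeasure (γ j) (u j + 1)).prod P₀)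
        ∂Measure.pi (fun p : Fin d × ι => gammaMeasure (labelCount g p.2 p.1 + γ p.1) (u p.1 + 1))
        ∂Measure.pi (fun _ : ι => P₀) := by
  have hp' : ∀ (k : ℕ) j, IsProbabilityMeasure (gammaMeasure (k + γ j) (u j + 1)) :=
    fun k j => isProbabilityMeasure_gammaMeasure_tilted (hγ j) (hu j) _
  have hp0 : ∀ j, IsProbabilityMeasure (gammaMeasure (γ j) (u j + 1)) :=
    fun j => by simpa using hp' 0 j
  have hm : Measurable fun ξ : ι ⊕ κ → (Fin d → ℝ) × X =>
      F (atomicSum ξ) (fun j i => (ξ (.inl (g j i))).2) :=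
    hF.comp (measurable_atomicSum.prodMk (by fun_prop))
  rw [tiltedPoints, lintegral_pi_sum _ hm]
  simp_rw [labelCount_comp_injective Sum.inl_injective, labelCount_inl_inr, Nat.cast_zero, zero_add,
    atomicSum_sumElim, Sum.elim_inl]
  refine lintegral_pi_weights_atoms (fun j l => gammaMeasure (labelCount g l j + γ j) (u j + 1)) P₀
    (f := fun x => ∫⁻ ξ, F (atomicSum x + atomicSum ξ) (fun j i => (x (g j i)).2)
      ∂Measure.pi (fun _ : κ => (Measure.pi fun j => gammaMeasure (γ j) (u j + 1)).prod P₀)) ?_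
  refine Measurable.lintegral_prod_right' (f := fun p : (ι → (Fin d → ℝ) × X) ×
    (κ → (Fin d → ℝ) × X) => F (atomicSum p.1 + atomicSum p.2) (fun j i => (p.1 (g j i)).2)) ?_
  exact hF.comp (((measurable_atomicSum.comp measurable_fst).add
    (measurable_atomicSum.comp measurable_snd)).prodMk (by fun_prop))

end Tilting

/-! ### The superposition of allocated and non-allocated components -/

section Superposition

variable {X : Type*} {d : ℕ} {n : Fin d → ℕ} {ι : Type*}

lemma mem_distinctValues_iff {t : ι → X} {g : (j : Fin d) → Fin (n j) → ι}
    (hg : ∀ b, ∃ j i, g j i = b) (x : X) :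
    x ∈ distinctValues (fun j i => t (g j i)) ↔ ∃ b, t b = x := by
  simp only [distinctValues, Finset.mem_image, Finset.mem_univ, true_and, Sigma.exists]
  constructor
  · rintro ⟨j, i, h⟩
    exact ⟨_, h⟩
  · rintro ⟨b, rfl⟩
    obtain ⟨j, i, rfl⟩ := hg b
    exact ⟨j, i, rfl⟩

/-- Blocks of entries correspond to the distinct values. -/
noncomputable def blockEquivDistinctValues {t : ι → X} (ht : Function.Injective t)
    {g : (j : Fin d) → Fin (n j) → ι} (hg : ∀ b, ∃ j i, g j i = b) :
    ι ≃ {x // x ∈ distinctValues fun j i => t (g j i)} :=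
  Equiv.ofBijective (fun b => ⟨t b, (mem_distinctValues_iff hg _).2 ⟨b, rfl⟩⟩)
    ⟨fun b b' h => ht (congrArg Subtype.val h), fun x => by
      obtain ⟨b, hb⟩ := (mem_distinctValues_iff hg _).1 x.2
      exact ⟨b, Subtype.ext hb⟩⟩

lemma count_eq_labelCount {t : ι → X} (ht : Function.Injective t)
    (g : (j : Fin d) → Fin (n j) → ι) (b : ι) (j : Fin d) :
    count (fun j i => t (g j i)) j (t b) = labelCount g b j := by
  unfold count labelCount
  congr 1
  ext i
  simp [ht.eq_iff]

variable [Fintype ι]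

lemma numClusters_eq_card {t : ι → X} (ht : Function.Injective t)
    {g : (j : Fin d) → Fin (n j) → ι} (hg : ∀ b, ∃ j i, g j i = b) :
    numClusters (fun j i => t (g j i)) = Fintype.card ι := by
  rw [numClusters, Fintype.card_congr (blockEquivDistinctValues ht hg), Fintype.card_coe]

variable [MeasurableSpace X]

/-- Replaces the index type of distinct values, which varies with the sample, by the fixed type of
blocks; both integration and measurability rely on this. -/
lemma superpositionLaw_eq_map {t : ι → X} (ht : Function.Injective t)
    {g : (j : Fin d) → Fin (n j) → ι} (hg : ∀ b, ∃ j i, g j i = b)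
    (Ha : Fin d → ℕ → Measure ℝ) [∀ j k, IsProbabilityMeasure (Ha j k)] (q : Measure ℕ)
    [IsProbabilityMeasure q] (Hna : Fin d → Measure ℝ) [∀ j, IsProbabilityMeasure (Hna j)]
    (P₀ : Measure X) [IsProbabilityMeasure P₀] :
    superpositionLaw (fun j i => t (g j i)) Ha q Hna P₀
      = ((Measure.pi fun p : Fin d × ι => Ha p.1 (labelCount g p.2 p.1)).prod
        (vecIFPP q Hna P₀)).map
          fun p => atomicSum (fun l => (fun j => p.1 (j, l), t l)) + p.2 := by
  have hV := isProbabilityMeasure_vecIFPP q Hna P₀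
  have hA : Measurable fun (s : Fin d × ι → ℝ) =>
      atomicSum (fun l => (fun j => s (j, l), t l)) :=
    measurable_atomicSum.comp (by fun_prop)
  have halloc : allocatedLaw (fun j i => t (g j i)) Ha
      = (Measure.pi fun p : Fin d × ι => Ha p.1 (labelCount g p.2 p.1)).map
        fun s => atomicSum (fun l => (fun j => s (j, l), t l)) := by
    set σ := blockEquivDistinctValues ht hg
    set e : Fin d × ι ≃ Fin d × {x // x ∈ distinctValues fun j i => t (g j i)} :=
      (Equiv.refl _).prodCongr σ
    have hS : Measurable fun (s : Fin d × {x // x ∈ distinctValues fun j i => t (g j i)} → ℝ)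
        (j : Fin d) => ∑ x : {x // x ∈ distinctValues fun j i => t (g j i)},
          ENNReal.ofReal (s (j, x)) • Measure.dirac (x : X) :=
      measurable_pi_lambda _ fun j => Finset.measurable_fun_sum _ fun x _ =>
        measurable_smul_dirac (by fun_prop) measurable_const
    have hμ : (fun p => Ha (e p).1 (count (fun j i => t (g j i)) (e p).1 (e p).2))
        = fun p : Fin d × ι => Ha p.1 (labelCount g p.2 p.1) :=
      funext fun p => congrArg (Ha p.1) (count_eq_labelCount ht g p.2 p.1)
    rw [allocatedLaw, ← Measure.pi_map_piCongrLeft e (fun p => Ha p.1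
      (count (fun j i => t (g j i)) p.1 p.2)),
      Measure.map_map hS (MeasurableEquiv.measurable _), hμ]
    congr 1
    · funext s j
      simp only [Function.comp_apply, atomicSum]
      rw [← σ.sum_comp]
      refine Finset.sum_congr rfl fun b _ => ?_
      have : MeasurableEquiv.piCongrLeft (fun _ => ℝ) e s (j, σ b) = s (j, b) := by
        rw [MeasurableEquiv.coe_piCongrLeft]
        exact Equiv.piCongrLeft_apply_apply (fun _ => ℝ) e s (j, b)
      rw [this]
      rfl
  rw [superpositionLaw, halloc]
  nth_rewrite 1 [← Measure.map_id (μ := vecIFPP q Hna P₀)]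
  rw [Measure.map_prod_map _ _ hA measurable_id, Measure.map_map (by fun_prop)
    (hA.prodMap measurable_id)]
  rfl

lemma lintegral_superpositionLaw {t : ι → X} (ht : Function.Injective t)
    {g : (j : Fin d) → Fin (n j) → ι} (hg : ∀ b, ∃ j i, g j i = b)
    (Ha : Fin d → ℕ → Measure ℝ) [∀ j k, IsProbabilityMeasure (Ha j k)] (q : Measure ℕ)
    [IsProbabilityMeasure q] (Hna : Fin d → Measure ℝ) [∀ j, IsProbabilityMeasure (Hna j)]
    (P₀ : Measure X) [IsProbabilityMeasure P₀] {f : (Fin d → Measure X) → ℝ≥0∞}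
    (hf : Measurable f) :
    ∫⁻ ν, f ν ∂superpositionLaw (fun j i => t (g j i)) Ha q Hna P₀
      = ∫⁻ s, ∑' m : ℕ, q {m} * ∫⁻ ξ,
          f (atomicSum (fun l => (fun j => s (j, l), t l)) + atomicVector ξ)
          ∂Measure.pi (fun _ : Fin m => (Measure.pi Hna).prod P₀)
        ∂Measure.pi (fun p : Fin d × ι => Ha p.1 (labelCount g p.2 p.1)) := by
  have hV := isProbabilityMeasure_vecIFPP q Hna P₀
  have hA : Measurable fun (s : Fin d × ι → ℝ) =>
      atomicSum (fun l => (fun j => s (j, l), t l)) :=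
    measurable_atomicSum.comp (by fun_prop)
  have hm : Measurable fun p : (Fin d × ι → ℝ) × (Fin d → Measure X) =>
      atomicSum (fun l => (fun j => p.1 (j, l), t l)) + p.2 :=
    (hA.comp measurable_fst).add measurable_snd
  rw [superpositionLaw_eq_map ht hg, lintegral_map hf hm, lintegral_prod _
    (by exact (hf.comp hm).aemeasurable)]
  refine lintegral_congr fun s => ?_
  refine lintegral_vecIFPP _ _ _
    (f := fun ν => f (atomicSum (fun l => (fun j => s (j, l), t l)) + ν)) ?_
  exact hf.comp (measurable_id.const_add _)

end Superposition

/-! ### The posterior law -/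

section Posterior

variable {X : Type*} [MeasurableSpace X] {d : ℕ} {n : Fin d → ℕ}

/-- The posterior law of the unnormalized measures, given the sample and the auxiliary variables. -/
noncomputable def posterior (Λ : ℝ≥0) (γ : Fin d → ℝ) (P₀ : Measure X)
    (θ : (j : Fin d) → Fin (n j) → X) (u : Fin d → ℝ) : Measure (Fin d → Measure X) :=
  superpositionLaw θ (fun j k => gammaMeasure (k + γ j) (u j + 1))
    (poissonMixture (Λ * psiProd γ u) (numClusters θ)) (fun j => gammaMeasure (γ j) (u j + 1)) P₀

noncomputable instance {α : Type*} [Finite α] (s : Setoid α) : Fintype (Quotient s) :=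
  Fintype.ofFinite _

/-- The product of the total masses of the tilted weight laws over all components. -/
noncomputable def labelWeight {ι : Type*} [Fintype ι] (γ u : Fin d → ℝ)
    (c : (j : Fin d) → Fin (n j) → ι) : ℝ≥0∞ :=
  ∏ l, ∏ j, ENNReal.ofReal (gammaWeight (γ j) (labelCount c l j) (u j))

lemma labelWeight_comp_equiv {ι κ : Type*} [Fintype ι] [Fintype κ] (γ u : Fin d → ℝ) (e : ι ≃ κ)
    (c : (j : Fin d) → Fin (n j) → ι) :
    labelWeight γ u (fun j i => e (c j i)) = labelWeight γ u c := by
  unfold labelWeight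
  rw [← e.prod_comp]
  simp_rw [labelCount_comp_injective e.injective]

/-- Source of the factor `ψ^m`: a component without a label has the Laplace transforms `gammaWeight
(γ j) 0 (u j)` as total masses. -/
lemma labelWeight_inl {ι : Type*} [Fintype ι] {γ u : Fin d → ℝ} (hγ : ∀ j, 0 < γ j)
    (hu : ∀ j, 0 ≤ u j) (m : ℕ) (c : (j : Fin d) → Fin (n j) → ι) :
    labelWeight γ u (fun j i => (Sum.inl (c j i) : ι ⊕ Fin m))
      = labelWeight γ u c * ENNReal.ofReal (psiProd γ u ^ m) := by
  unfold labelWeight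
  rw [Fintype.prod_sum_type]
  simp_rw [labelCount_comp_injective Sum.inl_injective, labelCount_inl_inr]
  rw [Finset.prod_const, Finset.card_univ, Fintype.card_fin,
    ← ENNReal.ofReal_prod_of_nonneg fun j _ => (gammaWeight_pos (hγ j) 0 (hu j)).le,
    ← psiProd_eq hγ hu, ENNReal.ofReal_pow (psiProd_pos hγ hu).le]

lemma exists_equiv_extending {ι A : Type*} [Fintype ι] [Fintype A] (e : ι ↪ A) {m : ℕ}
    (h : Fintype.card A = m + Fintype.card ι) : ∃ σ : ι ⊕ Fin m ≃ A, ∀ b, σ (.inl b) = e b := by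
  classical
  have hc : Fintype.card (Fin m) = Fintype.card ((Set.range e)ᶜ : Set A) := by
    rw [Fintype.card_compl_set, Set.card_range_of_injective e.injective, h, Fintype.card_fin]
    omega
  exact ⟨((Equiv.ofInjective e e.injective).sumCongr (Fintype.equivOfCardEq hc)).trans
    (Equiv.Set.sumCompl (Set.range e)), fun b => by simp⟩

lemma tsum_eq_tsum_add {f : ℕ → ℝ≥0∞} {K : ℕ} (h : ∀ m < K, f m = 0) :
    ∑' m, f m = ∑' m, f (m + K) := by
  rw [← ENNReal.summable.sum_add_tsum_nat_add' (k := K), Finset.sum_eq_zero, zero_add]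
  exact fun m hm => h m (Finset.mem_range.1 hm)

lemma atomicVector_apply_univ {m : ℕ} (ξ : Fin m → (Fin d → ℝ) × X) (j : Fin d) :
    atomicVector ξ j Set.univ = ∑ l, ENNReal.ofReal ((ξ l).1 j) := by
  simp [atomicVector]

/-- The exponential splits because total masses are sums of weights, and the sampled weights collect
into powers. Positivity keeps `ENNReal.ofReal` from truncating. -/
lemma exp_mul_prod_weights {m : ℕ} {ξ : Fin m → (Fin d → ℝ) × X} (hξ : ∀ l j, 0 < (ξ l).1 j)
    (u : Fin d → ℝ) (c : (j : Fin d) → Fin (n j) → Fin m) :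
    (∏ j, ENNReal.ofReal (Real.exp (-((atomicVector ξ j Set.univ).toReal * u j))))
        * ∏ j, ∏ i, ENNReal.ofReal ((ξ (c j i)).1 j)
      = ∏ l, ∏ j,
        ENNReal.ofReal (Real.exp (-(u j * (ξ l).1 j)) * (ξ l).1 j ^ labelCount c l j) := by
  rw [prod_comp_label c fun l j => ENNReal.ofReal ((ξ l).1 j)]
  simp_rw [fun l j => ENNReal.ofReal_mul (p := Real.exp (-(u j * (ξ l).1 j)))
    (q := (ξ l).1 j ^ labelCount c l j) (Real.exp_pos _).le, Finset.prod_mul_distrib]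
  congr 1
  · rw [Finset.prod_comm]
    refine Finset.prod_congr rfl fun j _ => ?_
    rw [← ENNReal.ofReal_prod_of_nonneg fun l _ => (Real.exp_pos _).le, ← Real.exp_sum,
      atomicVector_apply_univ, ENNReal.toReal_sum fun l _ => ENNReal.ofReal_ne_top]
    simp_rw [ENNReal.toReal_ofReal (hξ _ j).le]
    rw [Finset.sum_mul, Finset.sum_neg_distrib]
    simp_rw [mul_comm]
  · exact Finset.prod_congr rfl fun l _ => Finset.prod_congr rfl fun j _ =>
      (ENNReal.ofReal_pow (hξ l j).le _).symm

lemma ae_weights_pos {ι : Type*} [Fintype ι] {γ : Fin d → ℝ} (hγ : ∀ j, 0 < γ j)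
    (P₀ : Measure X) [IsProbabilityMeasure P₀] :
    ∀ᵐ ξ ∂Measure.pi (fun _ : ι => (Measure.pi fun j => gammaMeasure (γ j) 1).prod P₀),
      ∀ l j, 0 < (ξ l).1 j := by
  have hp : ∀ j, IsProbabilityMeasure (gammaMeasure (γ j) 1) :=
    fun j => isProbabilityMeasure_gammaMeasure (hγ j) one_pos
  refine ae_all_iff.2 fun l => ae_all_iff.2 fun j => ?_
  have h1 := (measurePreserving_eval (fun j => gammaMeasure (γ j) 1) j).quasiMeasurePreserving.ae
    (ae_pos_gammaMeasure (γ j) 1)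
  have h2 := (Measure.quasiMeasurePreserving_fst (μ := Measure.pi fun j => gammaMeasure (γ j) 1)
    (ν := P₀)).ae h1
  exact (measurePreserving_eval (fun _ : ι => (Measure.pi fun j => gammaMeasure (γ j) 1).prod P₀)
    l).quasiMeasurePreserving.ae h2

lemma lintegral_prior_labels {γ u : Fin d → ℝ} (hγ : ∀ j, 0 < γ j) (hu : ∀ j, 0 ≤ u j)
    (P₀ : Measure X) [IsProbabilityMeasure P₀]
    {F : (Fin d → Measure X) → ((j : Fin d) → Fin (n j) → X) → ℝ≥0∞}
    (hF : Measurable (Function.uncurry F)) (m : ℕ) :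
    ∫⁻ ξ, (∏ j, ENNReal.ofReal (Real.exp (-((atomicVector ξ j Set.univ).toReal * u j))))
        * ∑ c : (j : Fin d) → Fin (n j) → Fin m, (∏ j, ∏ i, ENNReal.ofReal ((ξ (c j i)).1 j))
          * F (atomicVector ξ) (fun j i => (ξ (c j i)).2)
        ∂Measure.pi (fun _ : Fin m => (Measure.pi fun j => gammaMeasure (γ j) 1).prod P₀)
      = ∑ c : (j : Fin d) → Fin (n j) → Fin m, labelWeight γ u c
          * ∫⁻ ξ, F (atomicSum ξ) (fun j i => (ξ (c j i)).2)
            ∂tiltedPoints γ u P₀ (labelCount c) := by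
  have hm : ∀ c : (j : Fin d) → Fin (n j) → Fin m,
      Measurable fun ξ : Fin m → (Fin d → ℝ) × X =>
        F (atomicSum ξ) (fun j i => (ξ (c j i)).2) :=
    fun c => hF.comp (measurable_atomicSum.prodMk (by fun_prop))
  have hd : ∀ c : (j : Fin d) → Fin (n j) → Fin m,
      Measurable fun ξ : Fin m → (Fin d → ℝ) × X => ∏ l, ∏ j,
        ENNReal.ofReal (Real.exp (-(u j * (ξ l).1 j)) * (ξ l).1 j ^ labelCount c l j) :=
    fun c => by fun_prop
  have hc : ∀ c : (j : Fin d) → Fin (n j) → Fin m, labelWeight γ u c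
      * ∫⁻ ξ, F (atomicSum ξ) (fun j i => (ξ (c j i)).2) ∂tiltedPoints γ u P₀ (labelCount c)
      = ∫⁻ ξ, (∏ l, ∏ j,
        ENNReal.ofReal (Real.exp (-(u j * (ξ l).1 j)) * (ξ l).1 j ^ labelCount c l j))
          * F (atomicSum ξ) (fun j i => (ξ (c j i)).2)
        ∂Measure.pi (fun _ : Fin m => (Measure.pi fun j => gammaMeasure (γ j) 1).prod P₀) := by
    intro c
    rw [labelWeight, ← smul_eq_mul, ← lintegral_smul_measure, ← pi_withDensity_tilt hγ hu,
      lintegral_withDensity_eq_lintegral_mul _ (hd c) (hm c)]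
    rfl
  simp_rw [hc]
  rw [← lintegral_finsetSum _ fun c _ => by exact (hd c).mul (hm c)]
  refine lintegral_congr_ae ?_
  filter_upwards [ae_weights_pos hγ P₀] with ξ hξ
  rw [Finset.mul_sum]
  refine Finset.sum_congr rfl fun c _ => ?_
  rw [← mul_assoc, exp_mul_prod_weights hξ]
  rfl

end Posterior

/-! ### From the prior to the posterior: summing over labellings and numbers of components -/

section PosteriorIdentity

variable {X : Type*} [MeasurableSpace X] {d : ℕ} {n : Fin d → ℕ}

/-- The integral of `F` over `m` non-allocated components and the allocated components located at
`τ_b`, `b : ι`, when the entries of the sample have labels `g`. -/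
noncomputable def superposedIntegral {ι : Type*} [Fintype ι] (γ u : Fin d → ℝ) (P₀ : Measure X)
    (g : (j : Fin d) → Fin (n j) → ι)
    (F : (Fin d → Measure X) → ((j : Fin d) → Fin (n j) → X) → ℝ≥0∞) (m : ℕ) : ℝ≥0∞ :=
  ∫⁻ t, ∫⁻ s, ∫⁻ ξ, F (atomicSum (fun l => (fun j => s (j, l), t l)) + atomicVector ξ)
      (fun j i => t (g j i))
      ∂Measure.pi (fun _ : Fin m => (Measure.pi fun j => gammaMeasure (γ j) (u j + 1)).prod P₀)
    ∂Measure.pi (fun p : Fin d × ι => gammaMeasure (labelCount g p.2 p.1 + γ p.1) (u p.1 + 1))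
    ∂Measure.pi (fun _ : ι => P₀)

/-- The right-hand side does not involve `e`: extending `e` to a bijection `ι ⊕ Fin m ≃ A` moves the
blocks to a standard position. -/
lemma labelWeight_mul_lintegral {ι A : Type*} [Fintype ι] [Fintype A] {γ u : Fin d → ℝ}
    (hγ : ∀ j, 0 < γ j) (hu : ∀ j, 0 ≤ u j) (P₀ : Measure X) [IsProbabilityMeasure P₀]
    (g : (j : Fin d) → Fin (n j) → ι) (e : ι ↪ A)
    {F : (Fin d → Measure X) → ((j : Fin d) → Fin (n j) → X) → ℝ≥0∞}
    (hF : Measurable (Function.uncurry F)) {m : ℕ} (h : Fintype.card A = m + Fintype.card ι) :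
    labelWeight γ u (fun j i => e (g j i))
        * ∫⁻ ξ, F (atomicSum ξ) (fun j i => (ξ (e (g j i))).2)
          ∂tiltedPoints γ u P₀ (labelCount fun j i => e (g j i))
      = labelWeight γ u g * ENNReal.ofReal (psiProd γ u ^ m)
        * superposedIntegral γ u P₀ g F m := by
  obtain ⟨σ, hσ⟩ := exists_equiv_extending e h
  simp_rw [← hσ]
  rw [labelWeight_comp_equiv γ u σ fun j i => Sum.inl (g j i), labelWeight_inl hγ hu,
    lintegral_tiltedPoints_reindex hγ hu P₀ σ fun j i => Sum.inl (g j i),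
    lintegral_tiltedPoints_inl hγ hu P₀ g hF]
  rfl

lemma card_embedding_fin {ι : Type*} [Fintype ι] (m : ℕ) [Fintype (ι ↪ Fin (m + Fintype.card ι))] :
    (Fintype.card (ι ↪ Fin (m + Fintype.card ι)) : ℝ≥0∞)
      = ENNReal.ofReal (((m + Fintype.card ι)! : ℝ) / (m ! : ℝ)) := by
  rw [Fintype.card_embedding_eq, Fintype.card_fin, ← ENNReal.ofReal_natCast,
    Nat.descFactorial_eq_div (Nat.le_add_left _ _), Nat.add_sub_cancel,
    Nat.cast_div (Nat.factorial_dvd_factorial (Nat.le_add_right _ _)) (by positivity)]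

lemma tsum_superposedIntegral [MeasurableEq X] {γ u : Fin d → ℝ} (hγ : ∀ j, 0 < γ j)
    (hu : ∀ j, 0 ≤ u j) {Λ : ℝ≥0} (hΛ : 0 < Λ) (P₀ : Measure X) [IsProbabilityMeasure P₀]
    [NullSingletonClass P₀] {ι : Type*} [Fintype ι] {g : (j : Fin d) → Fin (n j) → ι}
    (hg : ∀ b, ∃ j i, g j i = b)
    {F : (Fin d → Measure X) → ((j : Fin d) → Fin (n j) → X) → ℝ≥0∞}
    (hF : Measurable (Function.uncurry F)) :
    ∑' m : ℕ, poissonMixture (Λ * psiProd γ u) (Fintype.card ι) {m}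
        * superposedIntegral γ u P₀ g F m
      = ∫⁻ t, ∫⁻ ν, F ν (fun j i => t (g j i)) ∂posterior Λ γ P₀ (fun j i => t (g j i)) u
        ∂Measure.pi (fun _ : ι => P₀) := by
  have hp : ∀ j (k : ℕ), IsProbabilityMeasure (gammaMeasure (k + γ j) (u j + 1)) :=
    fun j k => isProbabilityMeasure_gammaMeasure_tilted (hγ j) (hu j) _
  have hp0 : ∀ j, IsProbabilityMeasure (gammaMeasure (γ j) (u j + 1)) :=
    fun j => by simpa using hp j 0
  have hr : 0 < Λ * psiProd γ u := mul_pos hΛ (psiProd_pos hγ hu)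
  have hmix := isProbabilityMeasure_poissonMixture hr (Fintype.card ι)
  have hm : ∀ m : ℕ, Measurable fun p : ((ι → X) × (Fin d × ι → ℝ)) ×
      (Fin m → (Fin d → ℝ) × X) =>
      F (atomicSum (fun l => (fun j => p.1.2 (j, l), p.1.1 l)) + atomicVector p.2)
        (fun j i => p.1.1 (g j i)) :=
    fun m => hF.comp (((measurable_atomicSum.comp (by fun_prop)).add
      (measurable_atomicVector.comp measurable_snd)).prodMk (by fun_prop))
  have hm' := fun m : ℕ => (hm m).lintegral_prod_right'
    (ν := Measure.pi (fun _ : Fin m => (Measure.pi fun j => gammaMeasure (γ j) (u j + 1)).prod P₀))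
  have hm'' := fun m : ℕ => (hm' m).lintegral_prod_right'
    (ν := Measure.pi fun p : Fin d × ι => gammaMeasure (labelCount g p.2 p.1 + γ p.1) (u p.1 + 1))
  have hpost : ∀ᵐ t ∂Measure.pi (fun _ : ι => P₀),
      ∫⁻ ν, F ν (fun j i => t (g j i)) ∂posterior Λ γ P₀ (fun j i => t (g j i)) u
      = ∑' m : ℕ, poissonMixture (Λ * psiProd γ u) (Fintype.card ι) {m} *
        ∫⁻ s, ∫⁻ ξ, F (atomicSum (fun l => (fun j => s (j, l), t l)) + atomicVector ξ)
          (fun j i => t (g j i))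
          ∂Measure.pi (fun _ : Fin m => (Measure.pi fun j => gammaMeasure (γ j) (u j + 1)).prod P₀)
        ∂Measure.pi (fun p : Fin d × ι =>
          gammaMeasure (labelCount g p.2 p.1 + γ p.1) (u p.1 + 1)) := by
    -- Diffuseness of `P₀` enters here: for injective `t`, the distinct values of the sample are in
    -- bijection with the blocks.
    filter_upwards [ae_injective_pi (ι := ι) P₀] with t ht
    have hFt : Measurable fun ν => F ν (fun j i => t (g j i)) :=
      hF.comp (measurable_id.prodMk measurable_const)
    rw [posterior, numClusters_eq_card ht hg, lintegral_superpositionLaw ht hg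
      (fun j k => gammaMeasure (k + γ j) (u j + 1)) _ _ P₀ hFt]
    have hmt := fun m => (hm' m).comp (measurable_prodMk_left (x := t))
    exact (lintegral_tsum fun m => ((hmt m).const_mul _).aemeasurable).trans
      (tsum_congr fun m => lintegral_const_mul _ (hmt m))
  rw [lintegral_congr_ae hpost, lintegral_tsum fun m => ((hm'' m).const_mul _).aemeasurable]
  exact tsum_congr fun m => (lintegral_const_mul _ (hm'' m)).symm

theorem tsum_lintegral_prior [MeasurableEq X] {γ u : Fin d → ℝ} (hγ : ∀ j, 0 < γ j)
    (hu : ∀ j, 0 ≤ u j) {Λ : ℝ≥0} (hΛ : 0 < Λ) (P₀ : Measure X) [IsProbabilityMeasure P₀]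
    [NullSingletonClass P₀]
    {F : (Fin d → Measure X) → ((j : Fin d) → Fin (n j) → X) → ℝ≥0∞}
    (hF : Measurable (Function.uncurry F)) :
    ∑' m : ℕ, shiftedPoisson Λ {m} *
      ∫⁻ ξ, (∏ j, ENNReal.ofReal (Real.exp (-((atomicVector ξ j Set.univ).toReal * u j))))
        * ∑ c : (j : Fin d) → Fin (n j) → Fin m, (∏ j, ∏ i, ENNReal.ofReal ((ξ (c j i)).1 j))
          * F (atomicVector ξ) (fun j i => (ξ (c j i)).2)
        ∂Measure.pi (fun _ : Fin m => (Measure.pi fun j => gammaMeasure (γ j) 1).prod P₀)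
      = ∑ s : Setoid ((j : Fin d) × Fin (n j)), labelWeight γ u (blockOf s)
          * ENNReal.ofReal (poissonMixtureConst Λ (psiProd γ u) (Fintype.card (Quotient s)))
          * ∫⁻ t, ∫⁻ ν, F ν (fun j i => t (blockOf s j i))
            ∂posterior Λ γ P₀ (fun j i => t (blockOf s j i)) u
            ∂Measure.pi (fun _ : Quotient s => P₀) := by
  classical
  have hψ := psiProd_pos hγ hu
  simp_rw [lintegral_prior_labels hγ hu P₀ hF, sum_labels_eq_sum_partitions, Finset.mul_sum]
  rw [Summable.tsum_finsetSum fun _ _ => ENNReal.summable]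
  refine Finset.sum_congr rfl fun s _ => ?_
  rw [tsum_eq_tsum_add (K := Fintype.card (Quotient s)), ← tsum_superposedIntegral hγ hu hΛ P₀
    (blockOf_surjective s) hF, ← ENNReal.tsum_mul_left]
  · refine tsum_congr fun m => ?_
    rw [Finset.sum_congr rfl fun e _ => congrArg _ (labelWeight_mul_lintegral hγ hu P₀ (blockOf s)
      e hF (m := m) (Fintype.card_fin _)), Finset.sum_const, Finset.card_univ, nsmul_eq_mul,
      card_embedding_fin]
    have h := shiftedPoisson_mul_factorial_ratio hΛ hψ (Fintype.card (Quotient s)) m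
    rw [ENNReal.ofReal_mul (by positivity)] at h
    calc _ = (shiftedPoisson Λ {m + Fintype.card (Quotient s)}
          * (ENNReal.ofReal (((m + Fintype.card (Quotient s))! : ℝ) / (m ! : ℝ))
            * ENNReal.ofReal (psiProd γ u ^ m)))
          * (labelWeight γ u (blockOf s) * superposedIntegral γ u P₀ (blockOf s) F m) := by ring
      _ = _ := by rw [h]; ring
  · intro m hm
    have : IsEmpty (Quotient s ↪ Fin m) :=
      Function.Embedding.isEmpty_of_card_lt (by simpa using hm)
    simp

end PosteriorIdentity

/-! ### The likelihood of the sample and the auxiliary variables -/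

section Likelihood

lemma isProbabilityMeasure_normalized {A : Type*} [MeasurableSpace A] {ν : Measure A}
    (h0 : ν Set.univ ≠ 0) (ht : ν Set.univ ≠ ∞) : IsProbabilityMeasure (normalized ν) where
  measure_univ := by
    rw [normalized, Measure.smul_apply, smul_eq_mul, ENNReal.inv_mul_cancel h0 ht]

variable {X : Type*} [MeasurableSpace X] {d : ℕ} (n : Fin d → ℕ)

lemma sampleLaw_atomicVector {m : ℕ} {ξ : Fin m → (Fin d → ℝ) × X}
    (h0 : ∀ j, atomicVector ξ j Set.univ ≠ 0) :
    sampleLaw n (atomicVector ξ) = (∏ j, (atomicVector ξ j Set.univ)⁻¹ ^ n j) •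
      ∑ c : (j : Fin d) → Fin (n j) → Fin m, (∏ j, ∏ i, ENNReal.ofReal ((ξ (c j i)).1 j)) •
        Measure.dirac (fun j i => (ξ (c j i)).2) := by
  have hn : ∀ j, normalized (atomicVector ξ j) = ∑ l, ((atomicVector ξ j Set.univ)⁻¹
      * ENNReal.ofReal ((ξ l).1 j)) • Measure.dirac (ξ l).2 := by
    intro j
    rw [normalized]
    nth_rewrite 2 [atomicVector]
    rw [Finset.smul_sum]
    simp_rw [smul_smul]
  have hfin : ∀ j l, (atomicVector ξ j Set.univ)⁻¹ * ENNReal.ofReal ((ξ l).1 j) ≠ ∞ :=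
    fun j l => ENNReal.mul_ne_top (ENNReal.inv_ne_top.2 (h0 j)) ENNReal.ofReal_ne_top
  have hinner : ∀ j, Measure.pi (fun _ : Fin (n j) => normalized (atomicVector ξ j))
      = ∑ c : Fin (n j) → Fin m, (∏ i, (atomicVector ξ j Set.univ)⁻¹
        * ENNReal.ofReal ((ξ (c i)).1 j)) • Measure.dirac fun i => (ξ (c i)).2 := by
    intro j
    rw [hn j]
    exact pi_sum_smul_dirac (fun _ l => (atomicVector ξ j Set.univ)⁻¹
      * ENNReal.ofReal ((ξ l).1 j)) (fun _ l => hfin j l) fun _ l => (ξ l).2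
  rw [sampleLaw]
  simp_rw [hinner]
  rw [pi_sum_smul_dirac _ fun j c => ENNReal.prod_ne_top fun i _ => hfin j (c i), Finset.smul_sum]
  refine Finset.sum_congr rfl fun c _ => ?_
  rw [smul_smul]
  congr 1
  simp [Finset.prod_mul_distrib]

lemma auxLaw_eq_withDensity (hn : ∀ j, 0 < n j) {ν : Fin d → Measure X}
    (h0 : ∀ j, ν j Set.univ ≠ 0) (ht : ∀ j, ν j Set.univ ≠ ∞) :
    auxLaw n ν = volume.withDensity fun u => (∏ j, ν j Set.univ ^ n j)
      * ((∏ j, gammaBase (n j) (u j))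
        * ∏ j, ENNReal.ofReal (Real.exp (-((ν j Set.univ).toReal * u j)))) := by
  have hT : ∀ j, 0 < (ν j Set.univ).toReal := fun j => ENNReal.toReal_pos (h0 j) (ht j)
  have hp : ∀ j, IsProbabilityMeasure
      ((volume : Measure ℝ).withDensity (gammaPDF (n j) (ν j Set.univ).toReal)) :=
    fun j => isProbabilityMeasure_gammaMeasure (by exact_mod_cast hn j) (hT j)
  rw [auxLaw]
  unfold gammaMeasure
  rw [pi_withDensity (fun j => gammaPDF (n j) (ν j Set.univ).toReal)
    fun j => measurable_gammaPDF _ _, volume_pi]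
  congr 1
  funext u
  simp_rw [gammaPDF_eq_base (hn _) (hT _), Finset.prod_mul_distrib, ENNReal.ofReal_toReal (ht _)]

lemma isProbabilityMeasure_sampleLaw {ν : Fin d → Measure X}
    (h0 : ∀ j, ν j Set.univ ≠ 0) (ht : ∀ j, ν j Set.univ ≠ ∞) :
    IsProbabilityMeasure (sampleLaw n ν) := by
  have := fun j => isProbabilityMeasure_normalized (h0 j) (ht j)
  unfold sampleLaw
  infer_instance

lemma isProbabilityMeasure_auxLaw (hn : ∀ j, 0 < n j) {ν : Fin d → Measure X}
    (h0 : ∀ j, ν j Set.univ ≠ 0) (ht : ∀ j, ν j Set.univ ≠ ∞) :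
    IsProbabilityMeasure (auxLaw n ν) := by
  have hp : ∀ j, IsProbabilityMeasure (gammaMeasure (n j) (ν j Set.univ).toReal) :=
    fun j => isProbabilityMeasure_gammaMeasure (by exact_mod_cast hn j)
      (ENNReal.toReal_pos (h0 j) (ht j))
  unfold auxLaw
  infer_instance

/-- The purpose of the auxiliary variables: the powers of the total masses in the two laws are
inverse to each other. Having a component with positive weights makes these masses nonzero. -/
lemma lintegral_sampleLaw_prod_auxLaw (hn : ∀ j, 0 < n j) {m : ℕ} (hm : m ≠ 0)
    {ξ : Fin m → (Fin d → ℝ) × X} (hξ : ∀ l j, 0 < (ξ l).1 j)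
    {f : ((j : Fin d) → Fin (n j) → X) × (Fin d → ℝ) → ℝ≥0∞} (hf : Measurable f) :
    ∫⁻ y, f y ∂(sampleLaw n (atomicVector ξ)).prod (auxLaw n (atomicVector ξ))
      = ∫⁻ u, (∏ j, gammaBase (n j) (u j))
        * ((∏ j, ENNReal.ofReal (Real.exp (-((atomicVector ξ j Set.univ).toReal * u j))))
        * ∑ c : (j : Fin d) → Fin (n j) → Fin m, (∏ j, ∏ i, ENNReal.ofReal ((ξ (c j i)).1 j))
          * f (fun j i => (ξ (c j i)).2, u)) := by
  have h0 : ∀ j, atomicVector ξ j Set.univ ≠ 0 := by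
    intro j
    rw [atomicVector_apply_univ]
    exact fun h => (ENNReal.ofReal_pos.2 (hξ ⟨0, Nat.pos_of_ne_zero hm⟩ j)).ne'
      (Finset.sum_eq_zero_iff.1 h _ (Finset.mem_univ _))
  have ht : ∀ j, atomicVector ξ j Set.univ ≠ ∞ := by
    intro j
    rw [atomicVector_apply_univ]
    exact ENNReal.sum_ne_top.2 fun l _ => ENNReal.ofReal_ne_top
  have := isProbabilityMeasure_sampleLaw n h0 ht
  have := isProbabilityMeasure_auxLaw n hn h0 ht
  have hd : Measurable fun u : Fin d → ℝ => (∏ j, atomicVector ξ j Set.univ ^ n j)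
      * ((∏ j, gammaBase (n j) (u j))
        * ∏ j, ENNReal.ofReal (Real.exp (-((atomicVector ξ j Set.univ).toReal * u j)))) := by
    have := fun j => (measurable_gammaBase (n j))
    fun_prop
  rw [lintegral_prod_symm _ hf.aemeasurable, auxLaw_eq_withDensity n hn h0 ht,
    lintegral_withDensity_eq_lintegral_mul _ hd hf.lintegral_prod_left']
  refine lintegral_congr fun u => ?_
  rw [Pi.mul_apply, sampleLaw_atomicVector n h0, lintegral_smul_measure,
    lintegral_finsetSum_measure]
  have hfu : Measurable fun θ => f (θ, u) := hf.comp measurable_prodMk_right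
  simp_rw [lintegral_smul_measure, smul_eq_mul, lintegral_dirac' _ hfu]
  have hc : (∏ j, atomicVector ξ j Set.univ ^ n j) * ∏ j, (atomicVector ξ j Set.univ)⁻¹ ^ n j
      = 1 := by
    rw [← Finset.prod_mul_distrib]
    refine Finset.prod_eq_one fun j _ => ?_
    rw [← mul_pow, ENNReal.mul_inv_cancel (h0 j) (ht j), one_pow]
  rw [mul_mul_mul_comm, hc, one_mul, mul_assoc]

end Likelihood

/-! ### The joint law -/

lemma tsum_mul_lintegral_lintegral {E : ℕ → Type*} {F : Type*} [∀ m, MeasurableSpace (E m)]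
    [MeasurableSpace F] (π : ∀ m, Measure (E m)) [∀ m, SFinite (π m)] (ν : Measure F) [SFinite ν]
    (q : ℕ → ℝ≥0∞) {B : F → ℝ≥0∞} (hB : Measurable B) (G : ∀ m, E m → F → ℝ≥0∞)
    (hG : ∀ m, Measurable fun p : E m × F => G m p.1 p.2) :
    ∑' m, q m * ∫⁻ x, ∫⁻ u, B u * G m x u ∂ν ∂π m
      = ∫⁻ u, B u * ∑' m, q m * ∫⁻ x, G m x u ∂π m ∂ν := by
  have hI : ∀ m, Measurable fun u => ∫⁻ x, G m x u ∂π m := fun m => (hG m).lintegral_prod_left'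
  simp_rw [← ENNReal.tsum_mul_left]
  refine Eq.trans (tsum_congr fun m => ?_)
    (lintegral_tsum fun m => (hB.mul ((hI m).const_mul (q m))).aemeasurable).symm
  have hGu : ∀ u, Measurable fun x => G m x u := fun u => (hG m).comp measurable_prodMk_right
  rw [lintegral_lintegral_swap ((hB.comp measurable_snd).mul (hG m)).aemeasurable]
  simp_rw [fun u => lintegral_const_mul (μ := π m) (B u) (hGu u)]
  rw [← lintegral_const_mul (q m) (by exact hB.mul (hI m))]
  exact lintegral_congr fun u => mul_left_comm _ _ _

section Joint

variable {X : Type*} [MeasurableSpace X] [MeasurableEq X] {d : ℕ} {n : Fin d → ℕ}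

lemma lintegral_joint (hn : ∀ j, 0 < n j) {Λ : ℝ≥0} (hΛ : 0 < Λ) {γ : Fin d → ℝ}
    (hγ : ∀ j, 0 < γ j) (P₀ : Measure X) [IsProbabilityMeasure P₀] [NullSingletonClass P₀]
    (κ : Kernel (Fin d → Measure X) (((j : Fin d) → Fin (n j) → X) × (Fin d → ℝ)))
    [IsMarkovKernel κ]
    (hκ : ∀ᵐ ν ∂vecFDP Λ γ P₀, κ ν = (sampleLaw n ν).prod (auxLaw n ν))
    {f : (Fin d → Measure X) × ((j : Fin d) → Fin (n j) → X) × (Fin d → ℝ) → ℝ≥0∞}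
    (hf : Measurable f) :
    ∫⁻ p, f p ∂(vecFDP Λ γ P₀ ⊗ₘ κ)
      = ∫⁻ u, (∏ j, gammaBase (n j) (u j)) * ∑ s : Setoid ((j : Fin d) × Fin (n j)),
          labelWeight γ u (blockOf s)
          * ENNReal.ofReal (poissonMixtureConst Λ (psiProd γ u) (Fintype.card (Quotient s)))
          * ∫⁻ t, ∫⁻ ν, f (ν, fun j i => t (blockOf s j i), u)
            ∂posterior Λ γ P₀ (fun j i => t (blockOf s j i)) u
            ∂Measure.pi (fun _ : Quotient s => P₀) := by
  have hp : ∀ j, IsProbabilityMeasure (gammaMeasure (γ j) 1) :=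
    fun j => isProbabilityMeasure_gammaMeasure (hγ j) one_pos
  have hV : IsProbabilityMeasure (vecFDP Λ γ P₀) := isProbabilityMeasure_vecIFPP _ _ _
  set π₀ : (m : ℕ) → Measure (Fin m → (Fin d → ℝ) × X) := fun m =>
    Measure.pi fun _ : Fin m => (Measure.pi fun j => gammaMeasure (γ j) 1).prod P₀ with hπ₀
  set G : (m : ℕ) → (Fin m → (Fin d → ℝ) × X) → (Fin d → ℝ) → ℝ≥0∞ := fun m ξ u =>
    (∏ j, ENNReal.ofReal (Real.exp (-((atomicVector ξ j Set.univ).toReal * u j))))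
      * ∑ c : (j : Fin d) → Fin (n j) → Fin m, (∏ j, ∏ i, ENNReal.ofReal ((ξ (c j i)).1 j))
        * f (atomicVector ξ, fun j i => (ξ (c j i)).2, u) with hG
  have hGm : ∀ m, Measurable fun p : (Fin m → (Fin d → ℝ) × X) × (Fin d → ℝ) => G m p.1 p.2 := by
    intro m
    have hT : ∀ j, Measurable fun ξ : Fin m → (Fin d → ℝ) × X => atomicVector ξ j Set.univ :=
      fun j => (Measure.measurable_coe MeasurableSet.univ).comp
        ((measurable_pi_apply j).comp measurable_atomicVector)
    refine Measurable.mul (Finset.measurable_fun_prod _ fun j _ => ?_)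
      (Finset.measurable_fun_sum _ fun c _ => Measurable.mul (by fun_prop) (hf.comp
        ((measurable_atomicVector.comp measurable_fst).prodMk (by fun_prop))))
    have := hT j
    fun_prop
  have hB : Measurable fun u : Fin d → ℝ => ∏ j, gammaBase (n j) (u j) := by
    have := fun j => (measurable_gammaBase (n j))
    fun_prop
  -- The kernel is only known almost everywhere under the prior, which gives information for a
  -- number `m` of components only if `m` has positive mass.
  have hae : ∀ m, shiftedPoisson Λ {m} ≠ 0 → ∀ᵐ ξ ∂π₀ m, κ (atomicVector ξ)
      = (sampleLaw n (atomicVector ξ)).prod (auxLaw n (atomicVector ξ)) := by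
    intro m hm
    have h := Measure.ae_sum_iff.1 hκ m
    rw [Measure.ae_ennreal_smul_measure_iff hm] at h
    exact ae_of_ae_map measurable_atomicVector.aemeasurable h
  have hterm : ∀ m, shiftedPoisson Λ {m} * ∫⁻ ξ, ∫⁻ y, f (atomicVector ξ, y) ∂κ (atomicVector ξ)
      ∂π₀ m = shiftedPoisson Λ {m} * ∫⁻ ξ, ∫⁻ u, (∏ j, gammaBase (n j) (u j)) * G m ξ u
        ∂volume ∂π₀ m := by
    intro m
    by_cases hm : shiftedPoisson Λ {m} = 0
    · rw [hm, zero_mul, zero_mul]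
    -- With no component the measures are zero and cannot be normalized; the shift in `Pois₁`
    -- excludes this case.
    have hm0 : m ≠ 0 := by
      rintro rfl
      exact hm (shiftedPoisson_singleton_zero Λ)
    congr 1
    refine lintegral_congr_ae ?_
    filter_upwards [hae m hm, ae_weights_pos hγ P₀] with ξ h hξ
    rw [h]
    exact lintegral_sampleLaw_prod_auxLaw n hn hm0 hξ
      (f := fun y => f (atomicVector ξ, y)) (hf.comp measurable_prodMk_left)
  rw [Measure.lintegral_compProd hf, vecFDP,
    lintegral_vecIFPP _ _ _ hf.lintegral_kernel_prod_right',
    tsum_congr hterm, tsum_mul_lintegral_lintegral π₀ volume _ hB G hGm]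
  refine lintegral_congr fun u => ?_
  by_cases hu : ∀ j, 0 ≤ u j
  · rw [← tsum_lintegral_prior hγ hu hΛ P₀ (F := fun ν θ => f (ν, θ, u)) (hf.comp (by fun_prop))]
  · push Not at hu
    obtain ⟨j, hj⟩ := hu
    rw [Finset.prod_eq_zero (Finset.mem_univ j) (gammaBase_of_neg _ hj), zero_mul, zero_mul]

end Joint

/-! ### Measurability of the posterior -/

section Measurability

variable {A B C : Type*} [MeasurableSpace A] [MeasurableSpace B] [MeasurableSpace C]

lemma measurable_prod_measure {κ : A → Measure B} {η : A → Measure C}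
    [hκ' : ∀ a, IsProbabilityMeasure (κ a)] [hη' : ∀ a, IsProbabilityMeasure (η a)]
    (hκ : Measurable κ) (hη : Measurable η) : Measurable fun a => (κ a).prod (η a) := by
  let κ' : Kernel A B := ⟨κ, hκ⟩
  let η' : Kernel A C := ⟨η, hη⟩
  have : IsMarkovKernel κ' := ⟨hκ'⟩
  have : IsMarkovKernel η' := ⟨hη'⟩
  have h := (κ' ×ₖ η').measurable
  exact (funext fun a => Kernel.prod_apply κ' η' a : ⇑(κ' ×ₖ η') = _) ▸ h

lemma measurable_map_measure {κ : A → Measure B} [hκ' : ∀ a, IsProbabilityMeasure (κ a)]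
    (hκ : Measurable κ) {Φ : A × B → C} (hΦ : Measurable Φ) :
    Measurable fun a => (κ a).map fun b => Φ (a, b) := by
  let κ' : Kernel A B := ⟨κ, hκ⟩
  have : IsMarkovKernel κ' := ⟨hκ'⟩
  refine Measure.measurable_of_measurable_coe _ fun s hs => ?_
  have h := Kernel.measurable_kernel_prodMk_left (κ := κ') (hΦ hs)
  have heq : (fun a => (κ a).map (fun b => Φ (a, b)) s) = fun a => κ' a (Prod.mk a ⁻¹' (Φ ⁻¹' s)) :=
    funext fun a => Measure.map_apply (hΦ.comp measurable_prodMk_left) hs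
  rw [heq]
  exact h

variable {X : Type*} {d : ℕ} {n : Fin d → ℕ}

/-- The partition of the entries of `θ` into groups of equal values. -/
def tiePartition (θ : (j : Fin d) → Fin (n j) → X) : Setoid ((j : Fin d) × Fin (n j)) :=
  Setoid.ker fun p => θ p.1 p.2

/-- A value attached to each block of a partition. -/
noncomputable def blockValue (s : Setoid ((j : Fin d) × Fin (n j)))
    (θ : (j : Fin d) → Fin (n j) → X) (b : Quotient s) : X :=
  θ b.out.1 b.out.2

lemma blockValue_blockOf (θ : (j : Fin d) → Fin (n j) → X) (j : Fin d) (i : Fin (n j)) :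
    blockValue (tiePartition θ) θ (blockOf (tiePartition θ) j i) = θ j i :=
  Quotient.mk_out (s := tiePartition θ) (⟨j, i⟩ : (j : Fin d) × Fin (n j))

lemma blockValue_injective (θ : (j : Fin d) → Fin (n j) → X) :
    Function.Injective (blockValue (tiePartition θ) θ) := by
  intro b b' h
  rw [← Quotient.out_eq b, ← Quotient.out_eq b']
  exact Quotient.sound (s := tiePartition θ) h

variable [MeasurableSpace X]

lemma measurable_vecIFPP {q : A → Measure ℕ} (hq : ∀ m, Measurable fun a => q a {m})
    {H : A → Fin d → Measure ℝ} [∀ a j, IsProbabilityMeasure (H a j)]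
    (hH : ∀ j, Measurable fun a => H a j) (P₀ : Measure X) [IsProbabilityMeasure P₀] :
    Measurable fun a => vecIFPP (q a) (H a) P₀ := by
  refine Measure.measurable_of_measurable_coe _ fun s hs => ?_
  have hprod : Measurable fun a => (Measure.pi (H a)).prod P₀ :=
    measurable_prod_measure (measurable_pi_measure (fun j a => H a j) hH) measurable_const
  simp_rw [vecIFPP, Measure.sum_apply _ hs, Measure.smul_apply, smul_eq_mul,
    Measure.map_apply measurable_atomicVector hs]
  refine Measurable.tsum fun m => (hq m).mul ?_
  exact (Measure.measurable_coe (measurable_atomicVector hs)).comp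
    (measurable_pi_measure (fun (_ : Fin m) a => (Measure.pi (H a)).prod P₀) fun _ => hprod)

/-- A tie pattern is prescribed by finitely many coincidences or their negations, and there are
finitely many patterns. -/
lemma measurable_tiePartition [MeasurableEq X] :
    @Measurable _ _ _ ⊤ (tiePartition : ((j : Fin d) → Fin (n j) → X) → _) := by
  refine @measurable_to_countable' _ _ ⊤ _ _ _ fun s => ?_
  have : tiePartition ⁻¹' {s} = ⋂ (p : (j : Fin d) × Fin (n j)) (q : (j : Fin d) × Fin (n j)),
      {θ : (j : Fin d) → Fin (n j) → X | θ p.1 p.2 = θ q.1 q.2 ↔ s p q} := by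
    ext θ
    simp only [Set.mem_preimage, Set.mem_singleton_iff, Set.mem_iInter, Set.mem_ofPred_eq]
    exact ⟨fun h p q => h ▸ Iff.rfl, fun h => Setoid.ext fun p q => h p q⟩
  rw [this]
  refine MeasurableSet.iInter fun p => MeasurableSet.iInter fun q => ?_
  have he : MeasurableSet {θ : (j : Fin d) → Fin (n j) → X | θ p.1 p.2 = θ q.1 q.2} :=
    measurableSet_eq_fun (by fun_prop) (by fun_prop)
  by_cases h : s p q
  · simp only [h, iff_true]
    exact he
  · simp only [h, iff_false]
    exact he.compl

lemma measurable_psiProd {γ : Fin d → ℝ} (hγ : ∀ j, 0 < γ j) {v : A → Fin d → ℝ}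
    (hv : Measurable v) (hv0 : ∀ a j, 0 ≤ v a j) : Measurable fun a => psiProd γ (v a) := by
  simp_rw [fun a => psiProd_eq hγ (hv0 a)]
  have := fun j => measurable_gammaWeight (γ j) 0
  fun_prop

/-- For a fixed tie pattern the index types and label counts no longer depend on the sample; only
the locations and `u` vary. Measurability is then checked pattern by pattern. -/
lemma posterior_eq_map {γ u : Fin d → ℝ} (hγ : ∀ j, 0 < γ j) (hu : ∀ j, 0 ≤ u j) {Λ : ℝ≥0}
    (hΛ : 0 < Λ) (P₀ : Measure X) [IsProbabilityMeasure P₀] {s : Setoid ((j : Fin d) × Fin (n j))}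
    {θ : (j : Fin d) → Fin (n j) → X} (hs : tiePartition θ = s) :
    posterior Λ γ P₀ θ u = ((Measure.pi fun p : Fin d × Quotient s =>
        gammaMeasure (labelCount (blockOf s) p.2 p.1 + γ p.1) (u p.1 + 1)).prod
      (vecIFPP (poissonMixture (Λ * psiProd γ u) (Fintype.card (Quotient s)))
        (fun j => gammaMeasure (γ j) (u j + 1)) P₀)).map
        fun p => atomicSum (fun l => (fun j => p.1 (j, l), blockValue s θ l)) + p.2 := by
  have hp : ∀ j (k : ℕ), IsProbabilityMeasure (gammaMeasure (k + γ j) (u j + 1)) :=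
    fun j k => isProbabilityMeasure_gammaMeasure_tilted (hγ j) (hu j) _
  have hp0 : ∀ j, IsProbabilityMeasure (gammaMeasure (γ j) (u j + 1)) :=
    fun j => by simpa using hp j 0
  have hmix : ∀ K, IsProbabilityMeasure (poissonMixture (Λ * psiProd γ u) K) :=
    isProbabilityMeasure_poissonMixture (mul_pos hΛ (psiProd_pos hγ hu))
  subst hs
  have hθ : θ = fun j i => blockValue (tiePartition θ) θ (blockOf (tiePartition θ) j i) :=
    funext fun j => funext fun i => (blockValue_blockOf θ j i).symm
  have hK : numClusters θ = Fintype.card (Quotient (tiePartition θ)) := by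
    conv_lhs => rw [hθ]
    exact numClusters_eq_card (blockValue_injective θ) (blockOf_surjective _)
  have h := superpositionLaw_eq_map (blockValue_injective θ) (blockOf_surjective _)
    (fun j k => gammaMeasure (k + γ j) (u j + 1))
    (poissonMixture (Λ * psiProd γ u) (Fintype.card (Quotient (tiePartition θ))))
    (fun j => gammaMeasure (γ j) (u j + 1)) P₀
  rw [← hθ] at h
  rw [posterior, hK]
  exact h

lemma isProbabilityMeasure_posterior {γ u : Fin d → ℝ} (hγ : ∀ j, 0 < γ j) (hu : ∀ j, 0 ≤ u j)
    {Λ : ℝ≥0} (hΛ : 0 < Λ) (P₀ : Measure X) [IsProbabilityMeasure P₀]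
    (θ : (j : Fin d) → Fin (n j) → X) : IsProbabilityMeasure (posterior Λ γ P₀ θ u) := by
  have hp : ∀ j (k : ℕ), IsProbabilityMeasure (gammaMeasure (k + γ j) (u j + 1)) :=
    fun j k => isProbabilityMeasure_gammaMeasure_tilted (hγ j) (hu j) _
  have hp0 : ∀ j, IsProbabilityMeasure (gammaMeasure (γ j) (u j + 1)) :=
    fun j => by simpa using hp j 0
  have hmix : ∀ K, IsProbabilityMeasure (poissonMixture (Λ * psiProd γ u) K) :=
    isProbabilityMeasure_poissonMixture (mul_pos hΛ (psiProd_pos hγ hu))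
  have : ∀ K, IsProbabilityMeasure (vecIFPP (poissonMixture (Λ * psiProd γ u) K)
      (fun j => gammaMeasure (γ j) (u j + 1)) P₀) :=
    fun K => isProbabilityMeasure_vecIFPP _ _ _
  rw [posterior_eq_map hγ hu hΛ P₀ rfl]
  exact Measure.isProbabilityMeasure_map (((measurable_atomicSum.comp (by fun_prop)).add
    measurable_snd).aemeasurable)

lemma measurable_posterior [MeasurableEq X] {γ : Fin d → ℝ} (hγ : ∀ j, 0 < γ j)
    {Λ : ℝ≥0} (hΛ : 0 < Λ) (P₀ : Measure X) [IsProbabilityMeasure P₀]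
    {θ : A → (j : Fin d) → Fin (n j) → X} (hθ : Measurable θ) {v : A → Fin d → ℝ}
    (hv : Measurable v) (hv0 : ∀ a j, 0 ≤ v a j) :
    Measurable fun a => posterior Λ γ P₀ (θ a) (v a) := by
  have hp : ∀ a j (k : ℕ), IsProbabilityMeasure (gammaMeasure (k + γ j) (v a j + 1)) :=
    fun a j k => isProbabilityMeasure_gammaMeasure_tilted (hγ j) (hv0 a j) _
  have hp0 : ∀ a j, IsProbabilityMeasure (gammaMeasure (γ j) (v a j + 1)) :=
    fun a j => by simpa using hp a j 0
  have hr : ∀ a, 0 < Λ * psiProd γ (v a) := fun a => mul_pos hΛ (psiProd_pos hγ (hv0 a))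
  have hmix : ∀ a K, IsProbabilityMeasure (poissonMixture (Λ * psiProd γ (v a)) K) :=
    fun a => isProbabilityMeasure_poissonMixture (hr a)
  have hV : ∀ a K, IsProbabilityMeasure (vecIFPP (poissonMixture (Λ * psiProd γ (v a)) K)
      (fun j => gammaMeasure (γ j) (v a j + 1)) P₀) :=
    fun a K => isProbabilityMeasure_vecIFPP _ _ _
  have hg : ∀ (x : ℝ) j, Measurable fun a => gammaMeasure x (v a j + 1) :=
    fun x j => measurable_gammaMeasure x (by fun_prop)
  set R : Setoid ((j : Fin d) × Fin (n j)) → A → Measure (Fin d → Measure X) := fun s a =>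
    ((Measure.pi fun p : Fin d × Quotient s =>
        gammaMeasure (labelCount (blockOf s) p.2 p.1 + γ p.1) (v a p.1 + 1)).prod
      (vecIFPP (poissonMixture (Λ * psiProd γ (v a)) (Fintype.card (Quotient s)))
        (fun j => gammaMeasure (γ j) (v a j + 1)) P₀)).map
        fun p => atomicSum (fun l => (fun j => p.1 (j, l), blockValue s (θ a) l)) + p.2
  have hR : ∀ s, Measurable (R s) := by
    intro s
    refine measurable_map_measure (measurable_prod_measure
      (measurable_pi_measure (fun (p : Fin d × Quotient s) a =>
        gammaMeasure (labelCount (blockOf s) p.2 p.1 + γ p.1) (v a p.1 + 1)) fun p => hg _ _)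
      (measurable_vecIFPP (fun m => measurable_poissonMixture_singleton hr
        ((measurable_psiProd hγ hv hv0).const_mul _) _ m) (fun j => hg _ _) P₀))
      (Φ := fun q : A × (Fin d × Quotient s → ℝ) × (Fin d → Measure X) =>
        atomicSum (fun l => (fun j => q.2.1 (j, l), blockValue s (θ q.1) l)) + q.2.2) ?_
    have hb : ∀ l, Measurable fun a => blockValue s (θ a) l := fun l => by
      unfold blockValue
      fun_prop
    exact (measurable_atomicSum.comp (measurable_pi_lambda _ fun l => Measurable.prodMk
      (by fun_prop) ((hb l).comp measurable_fst))).add measurable_snd.snd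
  have heq : (fun a => posterior Λ γ P₀ (θ a) (v a)) = fun a => R (tiePartition (θ a)) a :=
    funext fun a => posterior_eq_map hγ (hv0 a) hΛ P₀ rfl
  rw [heq]
  let : MeasurableSpace (Setoid ((j : Fin d) × Fin (n j))) := ⊤
  exact (measurable_from_prod_countable_right (f := fun p : Setoid ((j : Fin d) × Fin (n j)) × A =>
    R p.1 p.2) hR).comp ((measurable_tiePartition.comp hθ).prodMk measurable_id)

end Measurability

/-! ### The conditional law -/

section Main

variable {X : Type*} [MeasurableSpace X] [MeasurableEq X] {d : ℕ} {n : Fin d → ℕ}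

theorem hasCondLaw_posterior (hn : ∀ j, 0 < n j) {Λ : ℝ≥0} (hΛ : 0 < Λ) {γ : Fin d → ℝ}
    (hγ : ∀ j, 0 < γ j) (P₀ : Measure X) [IsProbabilityMeasure P₀] [NullSingletonClass P₀]
    {Ω : Type*} [MeasurableSpace Ω] (P : Measure Ω) [IsProbabilityMeasure P]
    (μ : Ω → Fin d → Measure X) (Y : Ω → ((j : Fin d) → Fin (n j) → X) × (Fin d → ℝ))
    (hμ : HasLaw μ (vecFDP Λ γ P₀) P)
    (hY : HasCondLaw Y μ (fun ν => (sampleLaw n ν).prod (auxLaw n ν)) P) :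
    HasCondLaw μ Y (fun y => posterior Λ γ P₀ y.1 y.2) P := by
  obtain ⟨κ, hκ, hκe, hcd⟩ := hY
  rw [hμ.map_eq] at hκe
  have hj := hμ.prodMk_of_hasCondDistrib hcd
  have hYm : AEMeasurable Y P := hcd.aemeasurable_snd
  have hμm : AEMeasurable μ P := hμ.aemeasurable
  have habs : ∀ (u : Fin d → ℝ), (∀ j, 0 ≤ u j) → |u| = u := fun u hu => abs_of_nonneg hu
  -- The absolute value makes this a Markov kernel for every `u`, without changing it where all `u_j
  -- ≥ 0`, which has full probability.
  let ρ : Kernel (((j : Fin d) → Fin (n j) → X) × (Fin d → ℝ)) (Fin d → Measure X) :=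
    ⟨fun y => posterior Λ γ P₀ y.1 |y.2|, measurable_posterior hγ hΛ P₀ measurable_fst
      (measurable_pi_lambda _ fun j => by simp only [Pi.abs_apply]; fun_prop)
      fun y j => abs_nonneg (y.2 j)⟩
  have hρ : ∀ y, ρ y = posterior Λ γ P₀ y.1 |y.2| := fun y => rfl
  have hρM : IsMarkovKernel ρ :=
    ⟨fun y => isProbabilityMeasure_posterior hγ (fun j => abs_nonneg (y.2 j)) hΛ P₀ y.1⟩
  have hjoint : ∀ f : (Fin d → Measure X) × ((j : Fin d) → Fin (n j) → X) × (Fin d → ℝ) → ℝ≥0∞,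
      Measurable f → ∫⁻ ω, f (μ ω, Y ω) ∂P
        = ∫⁻ u, (∏ j, gammaBase (n j) (u j)) * ∑ s : Setoid ((j : Fin d) × Fin (n j)),
          labelWeight γ u (blockOf s)
          * ENNReal.ofReal (poissonMixtureConst Λ (psiProd γ u) (Fintype.card (Quotient s)))
          * ∫⁻ t, ∫⁻ ν, f (ν, fun j i => t (blockOf s j i), u)
            ∂posterior Λ γ P₀ (fun j i => t (blockOf s j i)) u
            ∂Measure.pi (fun _ : Quotient s => P₀) := by
    intro f hf
    rw [← lintegral_joint hn hΛ hγ P₀ κ hκe hf, ← hj.map_eq, lintegral_map' hf.aemeasurable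
      hj.aemeasurable]
  have hneg : ∀ u : Fin d → ℝ, (¬ ∀ j, 0 ≤ u j) → ∏ j, gammaBase (n j) (u j) = 0 := by
    intro u hu
    push Not at hu
    obtain ⟨j, hj⟩ := hu
    exact Finset.prod_eq_zero (Finset.mem_univ j) (gammaBase_of_neg _ hj)
  refine ⟨ρ, hρM, ?_, ?_, ?_⟩
  · have hS : MeasurableSet {y : ((j : Fin d) → Fin (n j) → X) × (Fin d → ℝ) | ∀ j, 0 ≤ y.2 j} := by
      rw [Set.ofPred_forall]
      exact MeasurableSet.iInter fun j => measurableSet_le measurable_const (by fun_prop)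
    -- The factor `gammaBase` vanishes at negative arguments, so the formula for the joint law gives
    -- the complement probability zero.
    have hpos : ∀ᵐ y ∂P.map Y, ∀ j, 0 ≤ y.2 j := by
      rw [ae_iff]
      have hS' : MeasurableSet
          {y : ((j : Fin d) → Fin (n j) → X) × (Fin d → ℝ) | ¬ ∀ j, 0 ≤ y.2 j} := hS.compl
      rw [← lintegral_indicator_one hS', lintegral_map' (measurable_one.indicator hS').aemeasurable
        hYm, hjoint (fun p => Set.indicator _ 1 p.2)
        ((measurable_one.indicator hS').comp measurable_snd)]
      rw [← lintegral_zero (μ := (volume : Measure (Fin d → ℝ)))]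
      refine lintegral_congr fun u => ?_
      by_cases hu : ∀ j, 0 ≤ u j
      · simp [hu]
      · rw [hneg u hu, zero_mul]
    filter_upwards [hpos] with y hy
    rw [hρ, habs _ hy]
  · exact hYm.prodMk hμm
  · refine Measure.ext fun S hS => ?_
    -- `hjoint` is applied twice: to the indicator of `S`, and to its integral under `ρ`. The latter
    -- is constant in `ν`, so integrating it against the posterior, a probability measure, changes
    -- nothing and both sides agree.
    rw [Measure.compProd_apply hS, lintegral_map' (Kernel.measurable_kernel_prodMk_left
      hS).aemeasurable hYm, hjoint (fun p => ρ p.2 (Prod.mk p.2 ⁻¹' S))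
      ((Kernel.measurable_kernel_prodMk_left hS).comp measurable_snd),
      ← lintegral_indicator_one hS, lintegral_map' (measurable_one.indicator hS).aemeasurable
      (hYm.prodMk hμm), hjoint (fun p => S.indicator 1 (p.2, p.1))
      ((measurable_one.indicator hS).comp measurable_swap)]
    refine lintegral_congr fun u => ?_
    by_cases hu : ∀ j, 0 ≤ u j
    · congr 1
      refine Finset.sum_congr rfl fun s _ => congrArg _ (lintegral_congr fun t => ?_)
      have := isProbabilityMeasure_posterior hγ hu hΛ P₀ fun j i => t (blockOf s j i)
      have hρu : ρ (fun j i => t (blockOf s j i), u)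
          = posterior Λ γ P₀ (fun j i => t (blockOf s j i)) u :=
        congrArg (posterior Λ γ P₀ fun j i => t (blockOf s j i)) (habs u hu)
      dsimp only
      rw [lintegral_const, measure_univ, mul_one, hρu,
        ← lintegral_indicator_one (measurable_prodMk_left hS)]
      rfl
    · rw [hneg u hu, zero_mul, zero_mul]

end Main

end VecFDP

theorem corollary1
    {X : Type*} [MeasurableSpace X] [StandardBorelSpace X]
    {d : ℕ} (n : Fin d → ℕ) (hn : ∀ j, 0 < n j)
    (Λ : ℝ≥0) (hΛ : 0 < Λ) (γ : Fin d → ℝ) (hγ : ∀ j, 0 < γ j)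
    (P₀ : Measure X) [IsProbabilityMeasure P₀] [NullSingletonClass P₀]
    {Ω : Type*} [MeasurableSpace Ω] (P : Measure Ω) [IsProbabilityMeasure P]
    (μ : Ω → Fin d → Measure X) (θ : Ω → (j : Fin d) → Fin (n j) → X) (U : Ω → Fin d → ℝ)
    -- the prior of the unnormalized measures
    (hμ : HasLaw μ (VecFDP.vecFDP Λ γ P₀) P)
    -- the sample and the auxiliary variables, given the unnormalized measures
    (hθU : VecFDP.HasCondLaw (fun ω => (θ ω, U ω)) μ
      (fun ν => (VecFDP.sampleLaw n ν).prod (VecFDP.auxLaw n ν)) P) :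
    -- the posterior of the unnormalized measures, given the sample and the auxiliary variables
    VecFDP.HasCondLaw μ (fun ω => (θ ω, U ω))
      (fun y : ((j : Fin d) → Fin (n j) → X) × (Fin d → ℝ) =>
        VecFDP.superpositionLaw y.1
          (fun j k => gammaMeasure (k + γ j) (y.2 j + 1))
          (VecFDP.poissonMixture (Λ * VecFDP.psiProd γ y.2) (VecFDP.numClusters y.1))
          (fun j => gammaMeasure (γ j) (y.2 j + 1))
          P₀) P ∧
    -- these ingredients are the general ones of the posterior of a normalized `Vec-IFPP`
    ∀ u : Fin d → ℝ, (∀ j, 0 < u j) →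
      (∀ j, ∀ k : ℕ, VecFDP.tiltedWeight (gammaMeasure (γ j) 1) (u j) k
        = gammaMeasure (k + γ j) (u j + 1)) ∧
      (∀ j, VecFDP.tiltedWeight (gammaMeasure (γ j) 1) (u j) 0 = gammaMeasure (γ j) (u j + 1)) ∧
      (∀ K : ℕ, VecFDP.qStar (VecFDP.shiftedPoisson Λ) K (VecFDP.psiProd γ u)
        = VecFDP.poissonMixture (Λ * VecFDP.psiProd γ u) K) := by
  refine ⟨VecFDP.hasCondLaw_posterior hn hΛ hγ P₀ P μ (fun ω => (θ ω, U ω)) hμ hθU, fun u hu => ?_⟩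
  have hu' : ∀ j, 0 ≤ u j := fun j => (hu j).le
  refine ⟨fun j k => VecFDP.tiltedWeight_gammaMeasure (hγ j) (hu' j) k, fun j => ?_,
    fun K => VecFDP.qStar_shiftedPoisson hΛ (VecFDP.psiProd_pos hγ hu') K⟩
  simpa using VecFDP.tiltedWeight_gammaMeasure (hγ j) (hu' j) 0
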